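/- Let $\Phi_1,\dots,\Phi_J:\mathbb{R}^d\to\mathbb{R}^d$ be similitudes with scaling ratios $0<r_j<1$, let $F=\bigcup_{j}\Phi_j(F)$ be the associated self-similar fractal (nonempty and compact), and let $C$ be its convex hull, with $\dim C=d$. Write $\Phi(A)=\bigcup_j\Phi_j(A)$. Assume the tileset condition (the sets $\Phi_j(\operatorname{int}C)$ are pairwise disjoint and contained in $\operatorname{int}C$) and the non-triviality condition $\operatorname{int}C\not\subseteq\Phi(C)$. Let $D$ be the real root of $\sum_j r_j^D=1$ and assume $d-1<D<d$. For a set $A$ let $V_A(\varepsilon)$ be the volume of $\{x\in A:\operatorname{dist}(x,A^c)\le\varepsilon\}$. Put $T_1=\operatorname{int}(C\setminus\Phi(C))$, $T_n=\Phi^{n-1}(T_1)$ and $V_{\mathcal T}(\varepsilon)=\sum_{n\ge1}V_{T_n}(\varepsilon)$. Assume that $T_1=:G$ is connected (a single generator), let $g$ be its inradius (the supremum of the radii of balls contained in $G$), and suppose that for some $0<h<g$ and real numbers $\kappa_0,\dots,\kappa_{d-1}$ \[ V_G(\varepsilon)=\sum_{i=0}^{d-1}\kappa_i\varepsilon^{d-i}\quad(0<\varepsilon<h),\qquad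 V_G(\varepsilon)=\lambda_G(\varepsilon)\quad(h\le\varepsilon\le g), \] where $\lambda_G$ is continuous and piecewise continuously differentiable on $[h,g]$. Put $\kappa_d=-\operatorname{vol}(G)$. Let $\zeta(s)=\dfrac{1}{1-\sum_j r_j^s}$ be the meromorphic continuation to $\mathbb{C}$ of the scaling zeta function $\sum_{k\ge0}\sum_{w\in\{1,\dots,J\}^k}(r_{w_1}\cdots r_{w_k})^s$ ($\operatorname{Re}s>D$), let $\mathfrak D$ be the set of its poles, let $\mathfrak D_{\mathcal T}=\mathfrak D\cup\{0,1,\dots,d-1\}$, and for $\varepsilon>0$ define \[ \zeta_{\mathcal T}(s,\varepsilon)=\zeta(s)\,\varepsilon^{d-s}\Bigl(\sum_{i=0}^{d-1}\frac{h^{s-i}}{s-i}\kappa_i+\frac{g^{s-d}}{s-d}\kappa_d+\Lambda(s)\Bigr),\qquad \Lambda(s)=\int_h^g u^{s-d-1}\lambda_G(u)\,du . \] Then, for every $0<\varepsilon<h$, the series $V_{\mathcal T}(\varepsilon)$ converges and \[ V_{\mathcal T}(\varepsilon)=\sum_{\omega\in\mathfrak D_{\mathcal T}}\operatorname{res}\bigl(\zeta_{\mathcal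 T}(s,\varepsilon);\omega\bigr), \] where the sum is understood as follows: each set $\{\omega\in\mathfrak D_{\mathcal T}:|\operatorname{Im}\omega|\le t\}$ is finite, and there is a strictly increasing sequence $\tau_n\to\infty$, not depending on $\varepsilon$, such that the sum is the limit as $n\to\infty$ of the finite sums over $\omega\in\mathfrak D_{\mathcal T}$ with $|\operatorname{Im}\omega|\le\tau_n$. -/

import Mathlib

open Filter Topology MeasureTheory

noncomputable section

/-- Euclidean space `ℝ^d`. -/
abbrev Euc (d : ℕ) : Type := EuclideanSpace ℝ (Fin d)

/-- The set map `A ↦ Φ_1(A) ∪ ⋯ ∪ Φ_J(A)` of a system of maps. -/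
def hutchinson {d J : ℕ} (Φ : Fin J → Euc d → Euc d) (A : Set (Euc d)) : Set (Euc d) :=
  ⋃ j, Φ j '' A

/-- `F` is a self-similar fractal: the nonempty compact invariant set of a system of similitudes
`Φ_j` with scaling ratios `r_j ∈ (0,1)`. -/
structure IsSelfSimilar {d J : ℕ} (Φ : Fin J → Euc d → Euc d) (r : Fin J → ℝ)
    (F : Set (Euc d)) : Prop where
  ratio_pos : ∀ j, 0 < r j
  ratio_lt_one : ∀ j, r j < 1
  similitude : ∀ j x y, dist (Φ j x) (Φ j y) = r j * dist x y
  nonempty : F.Nonempty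
  isCompact : IsCompact F
  invariant : F = hutchinson Φ F

/-- The tileset condition for `C`: the open set condition with `interior C` as a feasible
open set. -/
def TilesetCondition {d J : ℕ} (Φ : Fin J → Euc d → Euc d) (C : Set (Euc d)) : Prop :=
  (∀ j, Φ j '' interior C ⊆ interior C) ∧
    ∀ i j, i ≠ j → Disjoint (Φ i '' interior C) (Φ j '' interior C)

/-- The non-triviality condition for `C`. -/
def Nontriviality {d J : ℕ} (Φ : Fin J → Euc d → Euc d) (C : Set (Euc d)) : Prop :=
  ¬ interior C ⊆ hutchinson Φ C

/-- The sets of the tiling; `tile Φ C n` is `T_{n+1} = Φ^n (T_1)` with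
`T_1 = interior (C \ Φ(C))`. -/
def tile {d J : ℕ} (Φ : Fin J → Euc d → Euc d) (C : Set (Euc d)) (n : ℕ) : Set (Euc d) :=
  (hutchinson Φ)^[n] (interior (C \ hutchinson Φ C))

/-- The volume `V_A(ε)` of the inner `ε`-neighborhood of `A`, the set of the points of `A` whose
distance to the complement of `A` is at most `ε`. -/
def innerTubeVolume {d : ℕ} (A : Set (Euc d)) (ε : ℝ) : ℝ :=
  (volume : Measure (Euc d)).real {x | x ∈ A ∧ Metric.infDist x Aᶜ ≤ ε}

/-- The volume `V_𝒯(ε) = ∑ₙ V_{T_n}(ε)` of the inner `ε`-neighborhood of the tiling. -/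
def tilingTubeVolume {d J : ℕ} (Φ : Fin J → Euc d → Euc d) (C : Set (Euc d)) (ε : ℝ) : ℝ :=
  ∑' n, innerTubeVolume (tile Φ C n) ε

/-- The inradius: supremum of the radii of the balls contained in `A`. -/
def inradius {d : ℕ} (A : Set (Euc d)) : ℝ :=
  sSup {ρ : ℝ | 0 < ρ ∧ ∃ x, Metric.ball x ρ ⊆ A}

/-- `f` is continuous on `[a,b]`, and `[a,b]` is divided by finitely many points into closed
intervals on each of which `f` is continuously differentiable (one-sidedly at the ends). -/
def PiecewiseC1On (f : ℝ → ℝ) (a b : ℝ) : Prop :=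
  ContinuousOn f (Set.Icc a b) ∧
    ∃ (n : ℕ) (t : ℕ → ℝ), t 0 = a ∧ t n = b ∧
      ∀ i < n, t i < t (i + 1) ∧ ContDiffOn ℝ 1 f (Set.Icc (t i) (t (i + 1)))

/-- The Dirichlet series `∑_k ∑_{w ∈ W_k} r_w^s` over all words, where
`r_w = r_{w_1} ⋯ r_{w_k}`. -/
def scalingZetaSeries {J : ℕ} (r : Fin J → ℝ) (s : ℂ) : ℂ :=
  ∑' k : ℕ, ∑ w : Fin k → Fin J, ((∏ i, r (w i) : ℝ) : ℂ) ^ s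

/-- The scaling `ζ`-function as a meromorphic function on `ℂ`: the meromorphic continuation of
`scalingZetaSeries` (see `meromorphicOn_scalingZeta` and `hasSum_scalingZeta`). -/
def scalingZeta {J : ℕ} (r : Fin J → ℝ) (s : ℂ) : ℂ :=
  (1 - ∑ j, (r j : ℂ) ^ s)⁻¹

theorem meromorphicOn_scalingZeta {J : ℕ} (r : Fin J → ℝ) (hr : ∀ j, 0 < r j) :
    MeromorphicOn (scalingZeta r) Set.univ := by
  have h : Differentiable ℂ (fun s : ℂ => 1 - ∑ j, (r j : ℂ) ^ s) := by
    refine (differentiable_const _).sub (Differentiable.fun_sum fun j _ => ?_)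
    exact differentiable_id.const_cpow (Or.inl (by exact_mod_cast (hr j).ne'))
  intro z _
  exact (h.analyticAt z).meromorphicAt.inv

theorem hasSum_scalingZeta {J : ℕ} (r : Fin J → ℝ) (hr : ∀ j, 0 < r j) (hr1 : ∀ j, r j < 1)
    {D : ℝ} (hD : ∑ j, r j ^ D = 1) {s : ℂ} (hs : D < s.re) :
    HasSum (fun k : ℕ => ∑ w : Fin k → Fin J, ((∏ i, r (w i) : ℝ) : ℂ) ^ s)
      (scalingZeta r s) := by
  have hne : (Finset.univ : Finset (Fin J)).Nonempty := by
    by_contra h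
    rw [Finset.not_nonempty_iff_eq_empty] at h
    simp [h] at hD
  have hlt : ‖∑ j, (r j : ℂ) ^ s‖ < 1 := by
    refine (norm_sum_le _ _).trans_lt ?_
    rw [← hD]
    refine Finset.sum_lt_sum_of_nonempty hne fun j _ => ?_
    rw [Complex.norm_cpow_eq_rpow_re_of_pos (hr j)]
    exact Real.rpow_lt_rpow_of_exponent_gt (hr j) (hr1 j) hs
  have key : ∀ k : ℕ, ∑ w : Fin k → Fin J, ((∏ i, r (w i) : ℝ) : ℂ) ^ s
      = (∑ j, (r j : ℂ) ^ s) ^ k := by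
    intro k
    rw [Fintype.sum_pow]
    refine Finset.sum_congr rfl fun w _ => ?_
    rw [Complex.ofReal_prod]
    induction k with
    | zero => simp
    | succ k ih =>
      rw [Fin.prod_univ_succ, Fin.prod_univ_succ, ← ih (fun i => w i.succ) (Finset.mem_univ _),
        ← Complex.ofReal_prod,
        Complex.mul_cpow_ofReal_nonneg (hr _).le (Finset.prod_nonneg fun i _ => (hr _).le)]
  simp only [key]
  exact hasSum_geometric_of_norm_lt_one hlt

/-- On the half-plane `Re s > D` the function `scalingZeta` is the Dirichlet series. -/
theorem scalingZeta_eq_series {J : ℕ} (r : Fin J → ℝ) (hr : ∀ j, 0 < r j)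
    (hr1 : ∀ j, r j < 1) {D : ℝ} (hD : ∑ j, r j ^ D = 1) {s : ℂ} (hs : D < s.re) :
    scalingZetaSeries r s = scalingZeta r s :=
  (hasSum_scalingZeta r hr hr1 hD hs).tsum_eq

/-- The complex dimensions: the poles of the scaling `ζ`-function. -/
def complexDimensions {J : ℕ} (r : Fin J → ℝ) : Set ℂ :=
  {ω | meromorphicOrderAt (scalingZeta r) ω < 0}

/-- `𝔇_𝒯 = 𝔇 ∪ {0, 1, …, d-1}`. -/
def tilingDimensions {J : ℕ} (d : ℕ) (r : Fin J → ℝ) : Set ℂ :=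
  complexDimensions r ∪ {ω | ∃ i : ℕ, i < d ∧ ω = i}

/-- `Λ(s) = ∫_h^g u^{s-d-1} λ(u) du`. -/
def Lam (d : ℕ) (h g : ℝ) (lam : ℝ → ℝ) (s : ℂ) : ℂ :=
  ∫ u in h..g, (u : ℂ) ^ (s - d - 1) * (lam u : ℂ)

/-- The geometric `ζ`-function
`ζ(s) ε^{d-s} (∑_{i<d} κ_i h^{s-i}/(s-i) + κ_d g^{s-d}/(s-d) + Λ(s))`. -/
def geometricZeta {J : ℕ} (d : ℕ) (r : Fin J → ℝ) (κ : ℕ → ℝ) (h g : ℝ) (lam : ℝ → ℝ)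
    (ε : ℝ) (s : ℂ) : ℂ :=
  scalingZeta r s * (ε : ℂ) ^ ((d : ℂ) - s) *
    ((∑ i ∈ Finset.range d, (h : ℂ) ^ (s - i) / (s - i) * (κ i : ℂ)) +
      (g : ℂ) ^ (s - d) / (s - d) * (κ d : ℂ) + Lam d h g lam s)

/-- The residue of `f` at `ω`: the value of `(2πi)⁻¹ ∮ f` over small circles around `ω`
(for `f` meromorphic at `ω` it does not depend on the small radius). -/
def residue (f : ℂ → ℂ) (ω : ℂ) : ℂ :=
  limUnder (𝓝[>] (0 : ℝ)) fun ρ => (2 * Real.pi * Complex.I)⁻¹ * ∮ z in C(ω, ρ), f z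

end

/-!
Mellin inversion writes the inner tube volume `V_G` of the generator as an integral of
`ε^{d-s}` times the bracket in `geometricZeta` over a line `Re s = c` with `D < c < d`: this bracket
is the closed form of the Mellin transform of `V_G`, and it is integrable on the line because `V_G`
is continuous and piecewise `C¹`. Since the `Φ_j` are similitudes with disjoint images,
`V_{T_{n+1}}(ε) = ∑ r_j^d V_{T_n}(ε / r_j)`, which multiplies the Mellin transform by `∑ r_j^s`.
Summing the geometric series under the integral, which is possible because `∑ r_j^c < 1`, turns the
factor `(∑ r_j^s)^n` into `ζ(s)`, so `V_𝒯(ε)` is the integral of the geometric zeta function over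
`Re s = c`.

Shifting the line to `Re s = -∞` then collects the residues. The integrand has size
`(h / ε)^{Re s} / |s|` away from the poles and `ε < h`, so the far left side of a rectangle
contributes nothing, and horizontal sides at height `τ` contribute `O(1 / τ)` as long as
`1 - ∑ r_j^s` is bounded away from zero on them. Such heights exist by almost periodicity: the
translates of the denominator by a suitable sequence of integer heights converge, uniformly on
strips, to an exponential sum of the same kind, which has no zeros on some horizontal line.
-/

/-! ### Similitudes -/

section Similitude

variable {E : Type*} [NormedAddCommGroup E] {f : E → E} {c : ℝ}

theorem infDist_similitude_image {X Y : Type*} [PseudoMetricSpace X] [PseudoMetricSpace Y]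
    {f : X → Y} (hc : 0 ≤ c) (hf : ∀ x y, dist (f x) (f y) = c * dist x y) (x : X) (A : Set X) :
    Metric.infDist (f x) (f '' A) = c * Metric.infDist x A := by
  simp only [Metric.infDist_eq_iInf, Real.mul_iInf_of_nonneg hc, ← hf]
  exact (Set.imageFactorization_surjective (f := f) (s := A)).iInf_comp
    (fun y : f '' A => dist (f x) y) |>.symm

theorem exists_linearIsometryEquiv_of_similitude [NormedSpace ℝ E] [StrictConvexSpace ℝ E]
    [FiniteDimensional ℝ E] (hc : 0 < c) (hf : ∀ x y, dist (f x) (f y) = c * dist x y) :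
    ∃ L : E ≃ₗᵢ[ℝ] E, ∀ x, f x = c • L x + f 0 := by
  have hiso : Isometry fun x => c⁻¹ • f x := Isometry.of_dist_eq fun x y => by
    rw [dist_smul₀, hf, Real.norm_of_nonneg (inv_nonneg.2 hc.le), inv_mul_cancel_left₀ hc.ne']
  let A := hiso.affineIsometryOfStrictConvexSpace
  refine ⟨A.linearIsometry.toLinearIsometryEquiv rfl, fun x => ?_⟩
  have hA : c⁻¹ • f x = A.linearIsometry x + c⁻¹ • f 0 := by
    simpa [A] using A.map_vadd 0 x
  rw [LinearIsometry.toLinearIsometryEquiv_apply, ← smul_inv_smul₀ hc.ne' (f x), hA, smul_add,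
    smul_inv_smul₀ hc.ne']

theorem similitude_bijective [NormedSpace ℝ E] [StrictConvexSpace ℝ E] [FiniteDimensional ℝ E]
    (hc : 0 < c) (hf : ∀ x y, dist (f x) (f y) = c * dist x y) : Function.Bijective f := by
  obtain ⟨L, hL⟩ := exists_linearIsometryEquiv_of_similitude hc hf
  rw [funext hL]
  exact (AddGroup.addRight_bijective (f 0)).comp
    ((MulAction.bijective₀ hc.ne').comp L.bijective)

theorem isOpen_similitude_image [NormedSpace ℝ E] [StrictConvexSpace ℝ E] [FiniteDimensional ℝ E]
    (hc : 0 < c) (hf : ∀ x y, dist (f x) (f y) = c * dist x y) {A : Set E} (hA : IsOpen A) :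
    IsOpen (f '' A) := by
  obtain ⟨L, hL⟩ := exists_linearIsometryEquiv_of_similitude hc hf
  rw [funext hL]
  exact ((isOpenMap_add_right (f 0)).comp
    ((isOpenMap_smul₀ hc.ne').comp L.toHomeomorph.isOpenMap)) A hA

open Pointwise in
theorem volume_real_similitude_image [InnerProductSpace ℝ E] [FiniteDimensional ℝ E]
    [MeasurableSpace E] [BorelSpace E] (hc : 0 < c)
    (hf : ∀ x y, dist (f x) (f y) = c * dist x y) (A : Set E) :
    (volume : Measure E).real (f '' A) = c ^ Module.finrank ℝ E * volume.real A := by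
  obtain ⟨L, hL⟩ := exists_linearIsometryEquiv_of_similitude hc hf
  have himage : f '' A = (· + f 0) '' (c • (L '' A)) := by
    rw [← Set.image_smul, Set.image_image, Set.image_image]
    exact Set.image_congr fun x _ => hL x
  have hL_volume : volume (L '' A) = volume A := by
    rw [LinearIsometryEquiv.image_eq_preimage_symm]
    exact L.symm.measurePreserving.measure_preimage_equiv (f := L.symm.toMeasurableEquiv) A
  rw [himage, measureReal_def, Set.image_add_right, measure_preimage_add_right,
    Measure.addHaar_smul, hL_volume, measureReal_def, ENNReal.toReal_mul,
    abs_of_pos (pow_pos hc _), ENNReal.toReal_ofReal (pow_pos hc _).le]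

theorem innerTube_similitude_image [NormedSpace ℝ E] [StrictConvexSpace ℝ E]
    [FiniteDimensional ℝ E] (hc : 0 < c) (hf : ∀ x y, dist (f x) (f y) = c * dist x y)
    (A : Set E) (ε : ℝ) :
    {x | x ∈ f '' A ∧ Metric.infDist x (f '' A)ᶜ ≤ ε} =
      f '' {x | x ∈ A ∧ Metric.infDist x Aᶜ ≤ ε / c} := by
  have hbij := similitude_bijective hc hf
  ext y
  obtain ⟨x, rfl⟩ := hbij.2 y
  rw [hbij.1.mem_set_image, Set.mem_ofPred_eq, hbij.1.mem_set_image, ← Set.image_compl_eq hbij,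
    infDist_similitude_image hc.le hf, Set.mem_ofPred_eq, le_div_iff₀' hc]

theorem innerTubeVolume_similitude_image {d : ℕ} {f : Euc d → Euc d} (hc : 0 < c)
    (hf : ∀ x y, dist (f x) (f y) = c * dist x y) (A : Set (Euc d)) (ε : ℝ) :
    innerTubeVolume (f '' A) ε = c ^ d * innerTubeVolume A (ε / c) := by
  rw [innerTubeVolume, innerTube_similitude_image hc hf, volume_real_similitude_image hc hf,
    finrank_euclideanSpace_fin, innerTubeVolume]

end Similitude

/-! ### Inner tubes of the tiling -/

theorem infDist_compl_iUnion_of_disjoint {E ι : Type*} [NormedAddCommGroup E] [NormedSpace ℝ E]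
    [FiniteDimensional ℝ E] {U : ι → Set E} (hU : ∀ i, IsOpen (U i))
    (hdisj : Pairwise fun i j => Disjoint (U i) (U j)) (hne : (⋃ i, U i) ≠ Set.univ) {i : ι}
    {x : E} (hx : x ∈ U i) :
    Metric.infDist x (⋃ i, U i)ᶜ = Metric.infDist x (U i)ᶜ := by
  have hUi : U i ≠ Set.univ := fun h =>
    hne (Set.eq_univ_of_univ_subset (h ▸ Set.subset_iUnion U i))
  apply le_antisymm
  · obtain ⟨y, hy, hxy⟩ := exists_mem_frontier_infDist_compl_eq_dist hx hUi
    rw [hxy]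
    refine Metric.infDist_le_dist_of_mem ?_
    simp only [Set.mem_compl_iff, Set.mem_iUnion, not_exists]
    intro j hj
    rw [(hU i).frontier_eq] at hy
    rcases eq_or_ne i j with rfl | hij
    · exact hy.2 hj
    · exact ((hdisj hij).closure_left (hU j)).le_bot ⟨hy.1, hj⟩
  · exact Metric.infDist_le_infDist_of_subset
      (Set.compl_subset_compl.2 (Set.subset_iUnion U i)) (Set.nonempty_compl.2 hne)

theorem measurableSet_innerTube {X : Type*} [PseudoMetricSpace X] [MeasurableSpace X]
    [OpensMeasurableSpace X] {A : Set X} (hA : MeasurableSet A) (ε : ℝ) :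
    MeasurableSet {x | x ∈ A ∧ Metric.infDist x Aᶜ ≤ ε} :=
  hA.inter (measurableSet_le (Metric.continuous_infDist_pt _).measurable measurable_const)

theorem innerTubeVolume_iUnion_of_disjoint {d : ℕ} {ι : Type*} [Fintype ι] {U : ι → Set (Euc d)}
    (hU : ∀ i, IsOpen (U i)) (hdisj : Pairwise fun i j => Disjoint (U i) (U j))
    (hne : (⋃ i, U i) ≠ Set.univ) (hfin : ∀ i, volume (U i) ≠ ⊤) (ε : ℝ) :
    innerTubeVolume (⋃ i, U i) ε = ∑ i, innerTubeVolume (U i) ε := by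
  have htube : {x | x ∈ (⋃ i, U i) ∧ Metric.infDist x (⋃ i, U i)ᶜ ≤ ε} =
      ⋃ i, {x | x ∈ U i ∧ Metric.infDist x (U i)ᶜ ≤ ε} := by
    ext x
    simp only [Set.mem_ofPred_eq, Set.mem_iUnion]
    constructor
    · rintro ⟨⟨i, hi⟩, hx⟩
      exact ⟨i, hi, (infDist_compl_iUnion_of_disjoint hU hdisj hne hi) ▸ hx⟩
    · rintro ⟨i, hi, hx⟩
      exact ⟨⟨i, hi⟩, (infDist_compl_iUnion_of_disjoint hU hdisj hne hi).symm ▸ hx⟩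
  rw [innerTubeVolume, htube, measureReal_iUnion_fintype
    (fun i j hij => (hdisj hij).mono (fun x hx => hx.1) (fun x hx => hx.1))
    (fun i => measurableSet_innerTube (hU i).measurableSet ε)
    (fun i => measure_ne_top_of_subset (fun x hx => hx.1) (hfin i))]
  rfl

section Tile

variable {d J : ℕ} {Φ : Fin J → Euc d → Euc d} {r : Fin J → ℝ} {C : Set (Euc d)}

theorem innerTubeVolume_hutchinson (hr : ∀ j, 0 < r j)
    (hΦ : ∀ j x y, dist (Φ j x) (Φ j y) = r j * dist x y) (htile : TilesetCondition Φ C)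
    (hC : Bornology.IsBounded C) (hd : 0 < d) {A : Set (Euc d)} (hA : IsOpen A)
    (hAC : A ⊆ interior C) (ε : ℝ) :
    innerTubeVolume (hutchinson Φ A) ε = ∑ j, r j ^ d * innerTubeVolume A (ε / r j) := by
  have : Nonempty (Fin d) := ⟨⟨0, hd⟩⟩
  have hsub : ∀ j, Φ j '' A ⊆ C := fun j =>
    (Set.image_mono hAC).trans ((htile.1 j).trans interior_subset)
  rw [hutchinson, innerTubeVolume_iUnion_of_disjoint]
  · exact Finset.sum_congr rfl fun j _ => innerTubeVolume_similitude_image (hr j) (hΦ j) A ε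
  · exact fun j => isOpen_similitude_image (hr j) (hΦ j) hA
  · exact fun i j hij => (htile.2 i j hij).mono (Set.image_mono hAC) (Set.image_mono hAC)
  · exact fun h => NormedSpace.unbounded_univ ℝ (Euc d)
      (h ▸ hC.subset (Set.iUnion_subset hsub))
  · exact fun j => (hC.subset (hsub j)).measure_lt_top.ne

theorem isOpen_tile (hr : ∀ j, 0 < r j) (hΦ : ∀ j x y, dist (Φ j x) (Φ j y) = r j * dist x y)
    (C : Set (Euc d)) (n : ℕ) : IsOpen (tile Φ C n) := by
  induction n with
  | zero => exact isOpen_interior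
  | succ n ih =>
    rw [tile, Function.iterate_succ_apply']
    exact isOpen_iUnion fun j => isOpen_similitude_image (hr j) (hΦ j) ih

theorem tile_subset_interior (htile : TilesetCondition Φ C) (n : ℕ) :
    tile Φ C n ⊆ interior C := by
  induction n with
  | zero => exact interior_mono Set.sdiff_subset
  | succ n ih =>
    rw [tile, Function.iterate_succ_apply']
    exact Set.iUnion_subset fun j => (Set.image_mono ih).trans (htile.1 j)

theorem innerTubeVolume_tile_succ (hr : ∀ j, 0 < r j)
    (hΦ : ∀ j x y, dist (Φ j x) (Φ j y) = r j * dist x y) (htile : TilesetCondition Φ C)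
    (hC : Bornology.IsBounded C) (hd : 0 < d) (n : ℕ) (ε : ℝ) :
    innerTubeVolume (tile Φ C (n + 1)) ε =
      ∑ j, r j ^ d * innerTubeVolume (tile Φ C n) (ε / r j) := by
  rw [tile, Function.iterate_succ_apply']
  exact innerTubeVolume_hutchinson hr hΦ htile hC hd (isOpen_tile hr hΦ C n)
    (tile_subset_interior htile n) ε

end Tile

/-! ### Regularity of the inner tube volume -/

theorem disjoint_infDist_level_closedBall {E : Type*} [NormedAddCommGroup E] [NormedSpace ℝ E]
    {S : Set E} {x y : E} (hy : y ∈ S) {ρ δ : ℝ} (hρ : 0 < ρ) (hxy : dist x y = ρ) (hδ : 0 < δ)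
    (hδρ : 2 * δ ≤ ρ) :
    Disjoint {z | Metric.infDist z S = ρ}
      (Metric.closedBall (x + (2 * δ / ρ) • (y - x)) δ) := by
  refine Set.disjoint_left.2 fun z (hz : Metric.infDist z S = ρ) hzball => ?_
  have hcentre : dist (x + (2 * δ / ρ) • (y - x)) y = ρ - 2 * δ := by
    rw [dist_eq_norm, show x + (2 * δ / ρ) • (y - x) - y = (1 - 2 * δ / ρ) • (x - y) by module,
      norm_smul, ← dist_eq_norm x y, hxy,
      Real.norm_of_nonneg (sub_nonneg.2 ((div_le_one hρ).2 hδρ))]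
    field_simp
  have hzS : Metric.infDist z S ≤ δ + (ρ - 2 * δ) :=
    calc Metric.infDist z S ≤ dist z y := Metric.infDist_le_dist_of_mem hy
      _ ≤ dist z _ + dist _ y := dist_triangle _ (x + (2 * δ / ρ) • (y - x)) _
      _ ≤ δ + (ρ - 2 * δ) := add_le_add hzball hcentre.le
  linarith

theorem measure_infDist_level_eq_zero {E : Type*} [NormedAddCommGroup E] [NormedSpace ℝ E]
    [FiniteDimensional ℝ E] [MeasurableSpace E] [BorelSpace E] (μ : Measure E) [μ.IsAddHaarMeasure]
    {S : Set E} (hS : IsClosed S) (hne : S.Nonempty) {ρ : ℝ} (hρ : 0 < ρ) :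
    μ {x | Metric.infDist x S = ρ} = 0 := by
  -- Towards a nearest point of `S` a point of the level set sees balls of comparable size which
  -- miss the level set, so that it is not a density point.
  set L : Set E := {x | Metric.infDist x S = ρ}
  have hdensity := IsUnifLocDoublingMeasure.ae_tendsto_measure_inter_div μ L 2
  rw [ae_restrict_iff'
    (measurableSet_eq_fun (Metric.continuous_infDist_pt _).measurable measurable_const)] at hdensity
  suffices ∀ᵐ x ∂μ, x ∉ L by simpa [ae_iff] using this
  filter_upwards [hdensity] with x hx hxL
  obtain ⟨y, hyS, hinf⟩ := hS.exists_infDist_eq_dist hne x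
  have hxy : dist x y = ρ := hinf.symm.trans hxL
  let centre : ℝ → E := fun δ => x + (2 * δ / ρ) • (y - x)
  have hmem : ∀ᶠ δ in 𝓝[>] (0 : ℝ), x ∈ Metric.closedBall (centre δ) (2 * δ) := by
    filter_upwards [self_mem_nhdsWithin] with δ (hδ : 0 < δ)
    rw [Metric.mem_closedBall, dist_self_add_right, norm_smul, ← dist_eq_norm, dist_comm, hxy,
      Real.norm_of_nonneg (by positivity), div_mul_cancel₀ _ hρ.ne']
  have hlim := hx hxL centre (fun δ => δ) tendsto_id hmem
  have hmiss : (fun δ => μ (L ∩ Metric.closedBall (centre δ) δ) /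
      μ (Metric.closedBall (centre δ) δ)) =ᶠ[𝓝[>] (0 : ℝ)] fun _ => 0 := by
    filter_upwards [self_mem_nhdsWithin, Ioo_mem_nhdsGT (half_pos hρ)] with δ hδ hδρ
    rw [(disjoint_infDist_level_closedBall hyS hρ hxy hδ (by linarith [hδρ.2])).inter_eq,
      measure_empty, ENNReal.zero_div]
  exact one_ne_zero (tendsto_nhds_unique (hlim.congr' hmiss) tendsto_const_nhds)

theorem continuousAt_measureReal_setOf_le {X : Type*} [MeasurableSpace X] (μ : Measure X)
    [IsFiniteMeasure μ] {f : X → ℝ} (hf : Measurable f) {a : ℝ} (ha : μ {x | f x = a} = 0) :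
    ContinuousAt (fun b => μ.real {x | f x ≤ b}) a := by
  have hne : ∀ᵐ x ∂μ, f x ≠ a := by simpa [ae_iff] using ha
  refine (ENNReal.tendsto_toReal (measure_ne_top μ _)).comp
    (tendsto_measure_of_ae_tendsto_indicator_of_isFiniteMeasure (𝓝 a)
      (measurableSet_le hf measurable_const) (fun b => measurableSet_le hf measurable_const) ?_)
  filter_upwards [hne] with x hx
  rcases hx.lt_or_gt with hlt | hgt
  · filter_upwards [lt_mem_nhds hlt] with b hb using iff_of_true hb.le hlt.le
  · filter_upwards [gt_mem_nhds hgt] with b hb using iff_of_false hb.not_ge hgt.not_ge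

section InnerTubeVolume

variable {d : ℕ} {A : Set (Euc d)}

theorem continuousAt_innerTubeVolume (hA : IsOpen A) (hfin : volume A ≠ ⊤) (hne : A ≠ Set.univ)
    {ε : ℝ} (hε : 0 < ε) : ContinuousAt (innerTubeVolume A) ε := by
  have : IsFiniteMeasure (volume.restrict A) := isFiniteMeasure_restrict.2 hfin
  have hdist : Measurable fun z => Metric.infDist z Aᶜ :=
    (Metric.continuous_infDist_pt _).measurable
  have hlevel := Measure.restrict_le_self.absolutelyContinuous (μ := volume.restrict A)
    (measure_infDist_level_eq_zero volume hA.isClosed_compl (Set.nonempty_compl.2 hne) hε)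
  refine (continuousAt_measureReal_setOf_le _ hdist hlevel).congr (Eventually.of_forall fun x => ?_)
  beta_reduce
  rw [measureReal_restrict_apply (measurableSet_le hdist measurable_const), innerTubeVolume,
    Set.inter_comm]
  rfl

theorem infDist_compl_le_inradius (hd : 0 < d) (hA : IsOpen A) (hb : Bornology.IsBounded A)
    {x : Euc d} (hx : x ∈ A) : Metric.infDist x Aᶜ ≤ inradius A := by
  have : Nonempty (Fin d) := ⟨⟨0, hd⟩⟩
  have hne : Aᶜ.Nonempty := Set.nonempty_compl.2 fun h =>
    NormedSpace.unbounded_univ ℝ (Euc d) (h ▸ hb)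
  refine le_csSup ⟨2 * Metric.diam A, ?_⟩ ⟨?_, x, Metric.ball_infDist_compl_subset⟩
  · rintro ρ ⟨hρ, y, hy⟩
    obtain ⟨v, hv⟩ := exists_norm_eq (Euc d) (half_pos hρ).le
    have hdiam := Metric.dist_le_diam_of_mem hb (hy (Metric.mem_ball_self hρ))
      (hy (show y + v ∈ Metric.ball y ρ by simp [hv, hρ]))
    rw [dist_self_add_right, hv] at hdiam
    linarith
  · exact (hA.isClosed_compl.notMem_iff_infDist_pos hne).1 (Set.notMem_compl_iff.2 hx)

theorem innerTubeVolume_eq_volume_of_inradius_le (hd : 0 < d) (hA : IsOpen A)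
    (hb : Bornology.IsBounded A) {ε : ℝ} (hε : inradius A ≤ ε) :
    innerTubeVolume A ε = volume.real A := by
  rw [innerTubeVolume]
  congr 1
  exact Set.sep_eq_self_iff_mem_true.2 fun z hz => (infDist_compl_le_inradius hd hA hb hz).trans hε

end InnerTubeVolume

/-! ### Mellin transforms of functions supported in a compact subinterval of `(0, ∞)` -/

open FourierTransform SchwartzMap in
theorem integral_smul_fourier_toLp_eq {f : ℝ → ℂ} (hf : Integrable f) (hf2 : MemLp f 2)
    (ψ : 𝓢(ℝ, ℂ)) :
    ∫ x, ψ x • (𝓕 (hf2.toLp f) : Lp ℂ 2 (volume : Measure ℝ)) x = ∫ x, ψ x • 𝓕 f x := by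
  have hdistribution := DFunLike.congr_fun (Lp.fourier_toTemperedDistribution_eq (hf2.toLp f)) ψ
  rw [TemperedDistribution.fourier_apply, Lp.toTemperedDistribution_apply,
    Lp.toTemperedDistribution_apply] at hdistribution
  calc ∫ x, ψ x • (𝓕 (hf2.toLp f) : Lp ℂ 2 (volume : Measure ℝ)) x
      = ∫ x, 𝓕 ψ x • hf2.toLp f x := hdistribution.symm
    _ = ∫ x, 𝓕 (ψ : ℝ → ℂ) x • f x := by
      refine integral_congr_ae ?_
      filter_upwards [hf2.coeFn_toLp] with x hx
      rw [hx, SchwartzMap.fourier_coe]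
    _ = ∫ x, ψ x • 𝓕 f x := by
      have hflip := VectorFourier.integral_fourierIntegral_smul_eq_flip (μ := volume)
        (ν := volume) (L := innerₗ ℝ) Real.continuous_fourierChar (by exact continuous_inner)
        ψ.integrable hf
      rwa [flip_innerₗ] at hflip

open FourierTransform in
theorem memLp_two_fourier_of_integrable {f : ℝ → ℂ} (hf : Integrable f) (hf2 : MemLp f 2) :
    MemLp (𝓕 f : ℝ → ℂ) 2 := by
  set u : Lp ℂ 2 (volume : Measure ℝ) := 𝓕 (hf2.toLp f)
  have hcont : Continuous (𝓕 f : ℝ → ℂ) :=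
    VectorFourier.fourierIntegral_continuous Real.continuous_fourierChar
      (by exact continuous_inner) hf
  refine (Lp.memLp u).ae_eq (ae_eq_of_integral_contDiff_smul_eq
    ((Lp.memLp u).locallyIntegrable (by norm_num)) hcont.locallyIntegrable fun φ hφ hφs => ?_)
  exact integral_smul_fourier_toLp_eq hf hf2 (HasCompactSupport.toSchwartzMap
    (hφs.comp_left (g := fun y : ℝ => (y : ℂ)) (by simp)) (Complex.ofRealCLM.contDiff.comp hφ))

section IndicatorIoc

variable {h g : ℝ} {φ : ℝ → ℂ}

theorem mellin_indicator_Ioc (hh : 0 < h) (hhg : h ≤ g) (φ : ℝ → ℂ) (s : ℂ) :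
    mellin ((Set.Ioc h g).indicator φ) s = ∫ u in h..g, (u : ℂ) ^ (s - 1) * φ u := by
  have hintegrand : (fun t : ℝ => (t : ℂ) ^ (s - 1) • (Set.Ioc h g).indicator φ t) =
      (Set.Ioc h g).indicator fun u : ℝ => (u : ℂ) ^ (s - 1) * φ u := by
    ext t
    by_cases ht : t ∈ Set.Ioc h g <;> simp [ht]
  rw [mellin, hintegrand, setIntegral_indicator measurableSet_Ioc,
    intervalIntegral.integral_of_le hhg,
    Set.inter_eq_right.2 (Set.Ioc_subset_Ioi_self.trans (Set.Ioi_subset_Ioi hh.le))]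

theorem differentiable_mellin_indicator_Ioc (hh : 0 < h) (hφ : IntegrableOn φ (Set.Ioc h g)) :
    Differentiable ℂ (mellin ((Set.Ioc h g).indicator φ)) := by
  intro s
  refine mellin_differentiableAt_of_isBigO_rpow (a := s.re + 1) (b := s.re - 1)
    (((integrable_indicator_iff measurableSet_Ioc).2
      hφ).locallyIntegrable.locallyIntegrableOn _) ?_ (by linarith) ?_ (by linarith)
  · refine Asymptotics.IsBigO.of_bound 0 ?_
    filter_upwards [eventually_gt_atTop g] with x hx
    simp [hx]
  · refine Asymptotics.IsBigO.of_bound 0 ?_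
    filter_upwards [Ioo_mem_nhdsGT hh] with x hx
    simp [hx.2.le]

theorem memLp_comp_exp_neg_indicator_Ioc {K : ℝ} (hh : 0 < h) (hφ : Measurable φ)
    (hK : ∀ u ∈ Set.Ioc h g, ‖φ u‖ ≤ K) (σ : ℝ) (p : ENNReal) :
    MemLp (fun u : ℝ => Real.exp (-σ * u) • (Set.Ioc h g).indicator φ (Real.exp (-u))) p := by
  set ψ : ℝ → ℂ := fun u => Real.exp (-σ * u) • (Set.Ioc h g).indicator φ (Real.exp (-u))
  set I := Set.Icc (-Real.log g) (-Real.log h)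
  have hψ_measurable : Measurable ψ :=
    (by fun_prop : Measurable fun u : ℝ => Real.exp (-σ * u)).smul
      ((hφ.indicator measurableSet_Ioc).comp (by fun_prop))
  obtain ⟨B, hB⟩ := (isCompact_Icc : IsCompact I).exists_bound_of_continuousOn
    (f := fun u : ℝ => Real.exp (-σ * u)) (by fun_prop)
  have hψ_support : I.indicator ψ = ψ := by
    refine Set.indicator_eq_self.2 fun u hu => ?_
    have hexp : Real.exp (-u) ∈ Set.Ioc h g := by
      by_contra hexp
      exact hu (by simp [ψ, hexp])
    have hupper := (Real.le_log_iff_exp_le (hh.trans (hexp.1.trans_le hexp.2))).2 hexp.2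
    have hlower := (Real.log_lt_iff_lt_exp hh).2 hexp.1
    exact ⟨by linarith, by linarith⟩
  rw [← hψ_support, memLp_indicator_iff_restrict measurableSet_Icc]
  refine MemLp.of_bound hψ_measurable.aestronglyMeasurable (B * max K 0) ?_
  filter_upwards [ae_restrict_mem measurableSet_Icc] with u hu
  rw [norm_smul]
  refine mul_le_mul (hB u hu) ?_ (norm_nonneg _) ((norm_nonneg _).trans (hB u hu))
  by_cases hexp : Real.exp (-u) ∈ Set.Ioc h g
  · simpa [hexp] using Or.inl (hK _ hexp)
  · simp [hexp]

theorem integrable_sq_norm_mellin_indicator_Ioc {K : ℝ} (hh : 0 < h) (hφ : Measurable φ)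
    (hK : ∀ u ∈ Set.Ioc h g, ‖φ u‖ ≤ K) (σ : ℝ) :
    Integrable fun t : ℝ => ‖mellin ((Set.Ioc h g).indicator φ) (σ + t * Complex.I)‖ ^ 2 := by
  have hmem := memLp_comp_exp_neg_indicator_Ioc hh hφ hK σ
  have hfourier := memLp_two_fourier_of_integrable (memLp_one_iff_integrable.1 (hmem 1)) (hmem 2)
  refine (((memLp_two_iff_integrable_sq_norm hfourier.1).1 hfourier).comp_div
    (R := 2 * Real.pi) (by positivity)).congr (Eventually.of_forall fun t => ?_)
  simp [mellin_eq_fourier]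

end IndicatorIoc

/-! ### Piecewise continuously differentiable functions -/

theorem exists_mem_Ioo_of_mem_Ioo_partition {α : Type*} [LinearOrder α] {t : ℕ → α} {n : ℕ}
    {u : α} (hu : u ∈ Set.Ioo (t 0) (t n)) (hut : ∀ i ≤ n, u ≠ t i) :
    ∃ i < n, u ∈ Set.Ioo (t i) (t (i + 1)) := by
  induction n with
  | zero => exact absurd (hu.1.trans hu.2) (lt_irrefl _)
  | succ n ih =>
    rcases (hut n n.le_succ).lt_or_gt with hlt | hgt
    · obtain ⟨i, hi, hui⟩ := ih ⟨hu.1, hlt⟩ fun i hi => hut i (hi.trans n.le_succ)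
      exact ⟨i, hi.trans n.lt_succ_self, hui⟩
    · exact ⟨n, n.lt_succ_self, hgt, hu.2⟩

namespace PiecewiseC1On

variable {f : ℝ → ℝ} {a b : ℝ}

theorem exists_finite_contDiffOn_pieces (hf : PiecewiseC1On f a b) :
    ∃ (S : Set ℝ) (P : Set (ℝ × ℝ)), S.Finite ∧ P.Finite ∧
      (∀ p ∈ P, p.1 < p.2 ∧ ContDiffOn ℝ 1 f (Set.Icc p.1 p.2)) ∧
      ∀ u ∈ Set.Icc a b \ S, ∃ p ∈ P, u ∈ Set.Ioo p.1 p.2 := by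
  obtain ⟨-, n, t, rfl, rfl, ht⟩ := hf
  refine ⟨t '' Set.Iic n, (fun i => (t i, t (i + 1))) '' Set.Iio n, (Set.finite_Iic n).image _,
    (Set.finite_Iio n).image _, Set.forall_mem_image.2 fun i hi => ht i hi, ?_⟩
  rintro u ⟨huI, huS⟩
  have hut : ∀ i ≤ n, u ≠ t i := fun i hi hu => huS ⟨i, hi, hu.symm⟩
  obtain ⟨i, hi, hui⟩ := exists_mem_Ioo_of_mem_Ioo_partition
    ⟨huI.1.lt_of_ne (hut 0 n.zero_le).symm, huI.2.lt_of_ne (hut n le_rfl)⟩ hut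
  exact ⟨_, ⟨i, hi, rfl⟩, hui⟩

theorem exists_finite_differentiableAt (hf : PiecewiseC1On f a b) :
    ∃ S : Set ℝ, S.Finite ∧ ∀ u ∈ Set.Icc a b \ S, DifferentiableAt ℝ f u := by
  obtain ⟨S, P, hS, -, hP, hcover⟩ := hf.exists_finite_contDiffOn_pieces
  refine ⟨S, hS, fun u hu => ?_⟩
  obtain ⟨p, hp, hup⟩ := hcover u hu
  exact ((hP p hp).2.differentiableOn one_ne_zero u
    (Set.Ioo_subset_Icc_self hup)).differentiableAt (Icc_mem_nhds hup.1 hup.2)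

theorem exists_abs_deriv_le (hf : PiecewiseC1On f a b) :
    ∃ K : ℝ, ∀ u ∈ Set.Icc a b, |deriv f u| ≤ K := by
  obtain ⟨S, P, hS, hPfin, hP, hcover⟩ := hf.exists_finite_contDiffOn_pieces
  have hpiece : ∀ p ∈ P, BddAbove ((fun u => |deriv f u|) '' Set.Ioo p.1 p.2) := by
    intro p hp
    obtain ⟨B, hB⟩ := isCompact_Icc.exists_bound_of_continuousOn
      ((hP p hp).2.continuousOn_derivWithin (uniqueDiffOn_Icc (hP p hp).1) le_rfl)
    refine ⟨B, Set.forall_mem_image.2 fun u hu => ?_⟩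
    simpa [derivWithin_of_mem_nhds (Icc_mem_nhds hu.1 hu.2)] using
      hB u (Set.Ioo_subset_Icc_self hu)
  obtain ⟨K, hK⟩ := (hS.image fun u => |deriv f u|).bddAbove.union
    ((hPfin.bddAbove_biUnion).2 hpiece)
  refine ⟨K, fun u hu => hK ?_⟩
  by_cases huS : u ∈ S
  · exact Or.inl ⟨u, huS, rfl⟩
  · obtain ⟨p, hp, hup⟩ := hcover u ⟨hu, huS⟩
    exact Or.inr (Set.mem_biUnion hp ⟨u, hup, rfl⟩)

end PiecewiseC1On

/-! ### The Mellin transform of a tube function -/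

section VerticalLine

variable {d : ℕ} {h g K : ℝ} {f : ℝ → ℝ}

theorem continuousOn_ofReal_cpow_const_Icc (hh : 0 < h) (z : ℂ) :
    ContinuousOn (fun u : ℝ => (u : ℂ) ^ z) (Set.Icc h g) := fun u hu =>
  (Complex.continuousAt_ofReal_cpow_const u z
    (Or.inr (hh.trans_le hu.1).ne')).continuousWithinAt

theorem Lam_eq_mellin (hh : 0 < h) (hhg : h ≤ g) (f : ℝ → ℝ) (s : ℂ) :
    Lam d h g f s = mellin ((Set.Ioc h g).indicator fun u : ℝ => (f u : ℂ)) (s - d) :=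
  (mellin_indicator_Ioc hh hhg _ _).symm

theorem differentiable_Lam (hh : 0 < h) (hhg : h ≤ g) (hf : IntegrableOn f (Set.Ioc h g)) :
    Differentiable ℂ (Lam d h g f) := by
  rw [funext (Lam_eq_mellin hh hhg f)]
  exact (differentiable_mellin_indicator_Ioc hh hf.ofReal).comp
    (differentiable_id.sub (differentiable_const _))

theorem norm_Lam_le (hh : 0 < h) (hhg : h ≤ g) (hK : ∀ u ∈ Set.Icc h g, |f u| ≤ K) {s : ℂ}
    (hs : s.re ≤ d + 1) : ‖Lam d h g f s‖ ≤ h ^ (s.re - d - 1) * K * (g - h) := by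
  rw [← abs_of_nonneg (sub_nonneg.2 hhg)]
  refine intervalIntegral.norm_integral_le_of_norm_le_const fun u hu => ?_
  rw [Set.uIoc_of_le hhg] at hu
  rw [norm_mul, Complex.norm_cpow_eq_rpow_re_of_pos (hh.trans hu.1), Complex.norm_real]
  refine mul_le_mul ?_ (hK u (Set.Ioc_subset_Icc_self hu)) (norm_nonneg _) (by positivity)
  simpa using Real.rpow_le_rpow_of_nonpos hh hu.1.le (by linarith)

theorem memLp_two_Lam_vertical (hh : 0 < h) (hhg : h ≤ g) (hf : Measurable f)
    (hK : ∀ u ∈ Set.Icc h g, |f u| ≤ K) (c : ℝ) :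
    MemLp (fun t : ℝ => Lam d h g f (c + t * Complex.I)) 2 := by
  have hK' : ∀ u ∈ Set.Ioc h g, ‖f u‖ ≤ K := fun u hu => hK u (Set.Ioc_subset_Icc_self hu)
  have hf_int : IntegrableOn f (Set.Ioc h g) :=
    Measure.integrableOn_of_bounded (by simp) hf.aestronglyMeasurable
      ((ae_restrict_mem measurableSet_Ioc).mono hK')
  have hcont : Continuous fun t : ℝ => Lam d h g f (c + t * Complex.I) :=
    (differentiable_Lam hh hhg hf_int).continuous.comp (by fun_prop)
  refine (memLp_two_iff_integrable_sq_norm hcont.aestronglyMeasurable).2 ?_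
  refine (integrable_sq_norm_mellin_indicator_Ioc hh (Complex.measurable_ofReal.comp hf)
    (fun u hu => by simpa using hK' u hu) (c - d)).congr (Eventually.of_forall fun t => ?_)
  simp only [Lam_eq_mellin hh hhg, Function.comp_def]
  congr 3
  push_cast
  ring

theorem norm_cpow_vertical {x : ℝ} (hx : 0 < x) (c a t : ℝ) :
    ‖(x : ℂ) ^ (c + t * Complex.I - a)‖ = x ^ (c - a) := by
  simp [Complex.norm_cpow_eq_rpow_re_of_pos hx]

theorem ne_natCast_of_sub_one_lt_of_lt {c : ℝ} {d : ℕ} (hdc : (d : ℝ) - 1 < c) (hcd : c < d)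
    (i : ℕ) : c ≠ i := by
  rintro rfl
  have hlt : (i : ℝ) + 1 ≤ d := by exact_mod_cast hcd
  linarith

theorem memLp_two_inv_vertical {c a : ℝ} (hca : c ≠ a) :
    MemLp (fun t : ℝ => ((c + t * Complex.I - a : ℂ))⁻¹) 2 := by
  have hca0 : c - a ≠ 0 := sub_ne_zero.2 hca
  have hmeas : Measurable fun t : ℝ => ((c + t * Complex.I - a : ℂ))⁻¹ := by fun_prop
  refine (memLp_two_iff_integrable_sq_norm hmeas.aestronglyMeasurable).2 ?_
  refine ((integrable_inv_one_add_sq.comp_div hca0).const_mul ((c - a) ^ 2)⁻¹).congr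
    (Eventually.of_forall fun t => ?_)
  have hnorm : ‖(c + t * Complex.I - a : ℂ)‖ ^ 2 = (c - a) ^ 2 + t ^ 2 := by
    rw [← Complex.normSq_eq_norm_sq, Complex.normSq_apply]
    simp
    ring
  simp only [norm_inv, inv_pow, hnorm, ← mul_inv]
  field_simp

theorem hasDerivAt_ofReal_cpow_mul {u : ℝ} (hu : 0 < u) (hf : DifferentiableAt ℝ f u) (z : ℂ) :
    HasDerivAt (fun u : ℝ => (u : ℂ) ^ z * (f u : ℂ))
      (z * ((u : ℂ) ^ (z - 1) * (f u : ℂ)) + (u : ℂ) ^ z * ((deriv f u : ℝ) : ℂ)) u := by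
  have hcpow := ((hasDerivAt_id (u : ℂ)).cpow_const (c := z)
    (Or.inl (by simpa using hu))).comp_ofReal
  refine (hcpow.mul hf.hasDerivAt.ofReal_comp).congr_deriv ?_
  simp only [id]
  ring

theorem sub_mul_Lam_eq_sub_Lam_deriv (hh : 0 < h) (hhg : h ≤ g) (hf : PiecewiseC1On f h g)
    (s : ℂ) : (s - d) * Lam d h g f s =
      (g : ℂ) ^ (s - d) * f g - (h : ℂ) ^ (s - d) * f h - Lam d h g (deriv f) (s + 1) := by
  obtain ⟨S, hS, hdiff⟩ := hf.exists_finite_differentiableAt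
  obtain ⟨K, hK⟩ := hf.exists_abs_deriv_le
  have hcont : ContinuousOn (fun u : ℝ => (f u : ℂ)) (Set.Icc h g) :=
    Complex.continuous_ofReal.comp_continuousOn hf.1
  have hint_f : IntervalIntegrable
      (fun u : ℝ => (s - d) * ((u : ℂ) ^ (s - d - 1) * (f u : ℂ))) volume h g :=
    ContinuousOn.intervalIntegrable_of_Icc hhg
      (continuousOn_const.mul ((continuousOn_ofReal_cpow_const_Icc hh _).mul hcont))
  have hint_deriv : IntervalIntegrable
      (fun u : ℝ => (u : ℂ) ^ (s - d) * ((deriv f u : ℝ) : ℂ)) volume h g := by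
    refine IntervalIntegrable.continuousOn_mul ?_
      (by rw [Set.uIcc_of_le hhg]; exact continuousOn_ofReal_cpow_const_Icc hh _)
    rw [intervalIntegrable_iff_integrableOn_Ioc_of_le hhg]
    refine Measure.integrableOn_of_bounded (M := K) (by simp)
      (Complex.measurable_ofReal.comp (measurable_deriv f)).aestronglyMeasurable ?_
    filter_upwards [ae_restrict_mem measurableSet_Ioc] with u hu
    simpa using hK u (Set.Ioc_subset_Icc_self hu)
  have hFTC := integral_eq_of_hasDerivAt_off_countable_of_le
    (fun u : ℝ => (u : ℂ) ^ (s - d) * (f u : ℂ)) _ hhg hS.countable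
    ((continuousOn_ofReal_cpow_const_Icc hh _).mul hcont)
    (fun u hu => hasDerivAt_ofReal_cpow_mul (hh.trans hu.1.1)
      (hdiff u ⟨Set.Ioo_subset_Icc_self hu.1, hu.2⟩) _) (hint_f.add hint_deriv)
  rw [intervalIntegral.integral_add hint_f hint_deriv,
    intervalIntegral.integral_const_mul] at hFTC
  have hexp : s + 1 - d - 1 = s - d := by ring
  rw [Lam, Lam, hexp]
  exact eq_sub_of_add_eq hFTC

end VerticalLine

/-- A function on `(0, ∞)` which is continuous, a polynomial without constant term on `(0, h)`,
equal to the piecewise `C¹` function `lam` on `[h, g]` and constant on `[g, ∞)`. It models the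
inner tube volume of a generator, with `κ d` minus the total volume. -/
structure IsTubeFunction (V : ℝ → ℝ) (d : ℕ) (κ : ℕ → ℝ) (h g : ℝ) (lam : ℝ → ℝ) : Prop where
  h_pos : 0 < h
  h_lt_g : h < g
  continuousAt : ∀ x, 0 < x → ContinuousAt V x
  eq_sum : ∀ x, 0 < x → x < h → V x = ∑ i ∈ Finset.range d, κ i * x ^ (d - i)
  eq_lam : ∀ x, h ≤ x → x ≤ g → V x = lam x
  piecewise : PiecewiseC1On lam h g
  eq_const : ∀ x, g ≤ x → V x = -κ d

/-- The closed form of the Mellin transform at `s - d` of a tube function, a meromorphic function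
on `ℂ` with poles at most at `0, 1, …, d`. -/
noncomputable def tubeTransform (d : ℕ) (κ : ℕ → ℝ) (h g : ℝ) (lam : ℝ → ℝ) (s : ℂ) : ℂ :=
  (∑ i ∈ Finset.range d, (h : ℂ) ^ (s - i) / (s - i) * (κ i : ℂ)) +
    (g : ℂ) ^ (s - d) / (s - d) * (κ d : ℂ) + Lam d h g lam s

namespace IsTubeFunction

variable {V : ℝ → ℝ} {d : ℕ} {κ : ℕ → ℝ} {h g : ℝ} {lam : ℝ → ℝ}

theorem lam_g (H : IsTubeFunction V d κ h g lam) : lam g = -κ d := by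
  rw [← H.eq_lam g H.h_lt_g.le le_rfl, H.eq_const g le_rfl]

theorem lam_h (H : IsTubeFunction V d κ h g lam) :
    lam h = ∑ i ∈ Finset.range d, κ i * h ^ (d - i) := by
  rw [← H.eq_lam h le_rfl H.h_lt_g.le]
  have hsum : Tendsto (fun x : ℝ => ∑ i ∈ Finset.range d, κ i * x ^ (d - i)) (𝓝[<] h)
      (𝓝 (∑ i ∈ Finset.range d, κ i * h ^ (d - i))) :=
    (Continuous.tendsto (by fun_prop) h).mono_left nhdsWithin_le_nhds
  refine tendsto_nhds_unique ((H.continuousAt h H.h_pos).mono_left nhdsWithin_le_nhds)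
    (hsum.congr' ?_)
  filter_upwards [Ioo_mem_nhdsLT H.h_pos] with x hx
  exact (H.eq_sum x hx.1 hx.2).symm

-- The boundary terms of the integration by parts cancel because `V` is continuous at `h` and `g`.
theorem sub_mul_tubeTransform (H : IsTubeFunction V d κ h g lam) {s : ℂ}
    (hs : ∀ i ≤ d, s ≠ (i : ℕ)) :
    (s - d) * tubeTransform d κ h g lam s =
      ∑ i ∈ Finset.range d, (h : ℂ) ^ (s - i) / (s - i) * ((κ i : ℂ) * (i - d)) -
        Lam d h g (deriv lam) (s + 1) := by
  have hsd : s - d ≠ 0 := sub_ne_zero.2 (hs d le_rfl)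
  have hh0 : (h : ℂ) ≠ 0 := by exact_mod_cast H.h_pos.ne'
  have hterm : ∀ i ∈ Finset.range d, (s - d) * ((h : ℂ) ^ (s - i) / (s - i) * (κ i : ℂ)) =
      (h : ℂ) ^ (s - i) / (s - i) * ((κ i : ℂ) * (i - d)) +
        (h : ℂ) ^ (s - d) * ((κ i : ℂ) * (h : ℂ) ^ (d - i)) := by
    intro i hi
    have hid : i ≤ d := (Finset.mem_range.1 hi).le
    have hsi : s - i ≠ 0 := sub_ne_zero.2 (hs i hid)
    have hpow : (h : ℂ) ^ (s - d) * (h : ℂ) ^ (d - i) = (h : ℂ) ^ (s - i) := by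
      rw [← Complex.cpow_natCast, ← Complex.cpow_add _ _ hh0, Nat.cast_sub hid]
      congr 1
      ring
    rw [mul_left_comm ((h : ℂ) ^ (s - d)), hpow]
    field_simp
    ring
  have hboundary_g : (s - d) * ((g : ℂ) ^ (s - d) / (s - d) * (κ d : ℂ)) =
      -((g : ℂ) ^ (s - d) * lam g) := by
    rw [H.lam_g]
    push_cast
    field_simp
  have hboundary_h : (h : ℂ) ^ (s - d) * lam h =
      ∑ i ∈ Finset.range d, (h : ℂ) ^ (s - d) * ((κ i : ℂ) * (h : ℂ) ^ (d - i)) := by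
    rw [H.lam_h, ← Finset.mul_sum]
    push_cast
    rfl
  rw [tubeTransform, mul_add, mul_add,
    sub_mul_Lam_eq_sub_Lam_deriv H.h_pos H.h_lt_g.le H.piecewise, hboundary_g, hboundary_h,
    Finset.mul_sum, Finset.sum_congr rfl hterm, Finset.sum_add_distrib]
  ring

theorem exists_norm_tubeTransform_le (H : IsTubeFunction V d κ h g lam) :
    ∃ K : ℝ, 0 ≤ K ∧ ∀ s : ℂ, s.re ≤ d → (∀ i ≤ d, 1 ≤ ‖s - (i : ℕ)‖) →
      ‖tubeTransform d κ h g lam s‖ ≤ K * h ^ s.re / ‖s - d‖ := by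
  obtain ⟨K, hK⟩ := H.piecewise.exists_abs_deriv_le
  have hh := H.h_pos
  have hK0 : 0 ≤ K := (abs_nonneg _).trans (hK h (Set.left_mem_Icc.2 H.h_lt_g.le))
  have hgh : 0 ≤ g - h := (sub_pos.2 H.h_lt_g).le
  refine ⟨∑ i ∈ Finset.range d, h ^ (-(i : ℝ)) * ‖(κ i : ℂ) * (i - d)‖ +
    h ^ (-(d : ℝ)) * K * (g - h), by positivity, fun s hs hdist => ?_⟩
  have hne : ∀ i ≤ d, s ≠ (i : ℕ) := fun i hi =>
    sub_ne_zero.1 (norm_pos_iff.1 (one_pos.trans_le (hdist i hi)))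
  have hterm : ∀ i ∈ Finset.range d, ‖(h : ℂ) ^ (s - i) / (s - i) * ((κ i : ℂ) * (i - d))‖ ≤
      h ^ (-(i : ℝ)) * ‖(κ i : ℂ) * (i - d)‖ * h ^ s.re := by
    intro i hi
    have hpow : ‖(h : ℂ) ^ (s - i)‖ = h ^ (-(i : ℝ)) * h ^ s.re := by
      rw [Complex.norm_cpow_eq_rpow_re_of_pos hh, ← Real.rpow_add hh]
      simp [sub_eq_neg_add]
    rw [norm_mul, norm_div, hpow, mul_right_comm]
    gcongr
    exact div_le_self (by positivity) (hdist i (Finset.mem_range.1 hi).le)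
  have hLam : ‖Lam d h g (deriv lam) (s + 1)‖ ≤ h ^ (-(d : ℝ)) * K * (g - h) * h ^ s.re := by
    refine (norm_Lam_le hh H.h_lt_g.le hK (by simpa using hs)).trans_eq ?_
    rw [Complex.add_re, Complex.one_re, show s.re + 1 - d - 1 = -d + s.re by ring,
      Real.rpow_add hh]
    ring
  rw [le_div_iff₀' (norm_pos_iff.2 (sub_ne_zero.2 (hne d le_rfl))), ← norm_mul,
    H.sub_mul_tubeTransform hne, add_mul, Finset.sum_mul]
  exact (norm_sub_le _ _).trans (add_le_add (norm_sum_le_of_le _ hterm) hLam)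

theorem isBigO_zero (H : IsTubeFunction V d κ h g lam) :
    (fun x => (V x : ℂ)) =O[𝓝[>] 0] fun x : ℝ => x := by
  have hsum : (fun x : ℝ => ∑ i ∈ Finset.range d, κ i * x ^ (d - i)) =O[𝓝 0] fun x => x := by
    refine Asymptotics.IsBigO.fun_sum fun i hi => Asymptotics.IsBigO.const_mul_left ?_ _
    obtain ⟨n, hn⟩ := Nat.exists_eq_add_of_lt (Finset.mem_range.1 hi)
    have hpow : (fun x : ℝ => x ^ n) =O[𝓝 0] fun _ => (1 : ℝ) :=
      ((continuous_pow n).tendsto 0).isBigO_one ℝ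
    simpa [hn, add_assoc, pow_succ] using hpow.mul (Asymptotics.isBigO_refl (fun x : ℝ => x) (𝓝 0))
  rw [← Asymptotics.isBigO_norm_left]
  simp only [Complex.norm_real, Asymptotics.isBigO_norm_left]
  refine (hsum.mono nhdsWithin_le_nhds).congr' ?_ EventuallyEq.rfl
  filter_upwards [Ioo_mem_nhdsGT H.h_pos] with x hx
  exact (H.eq_sum x hx.1 hx.2).symm

theorem isBigO_atTop (H : IsTubeFunction V d κ h g lam) :
    (fun x => (V x : ℂ)) =O[atTop] fun _ => (1 : ℝ) := by
  refine (Asymptotics.isBigO_const_const ((-κ d : ℝ) : ℂ) one_ne_zero atTop).congr' ?_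
    EventuallyEq.rfl
  filter_upwards [eventually_ge_atTop g] with x hx
  rw [H.eq_const x hx]

theorem mellinConvergent (H : IsTubeFunction V d κ h g lam) {z : ℂ} (hz : -1 < z.re)
    (hz0 : z.re < 0) : MellinConvergent (fun x => (V x : ℂ)) z := by
  refine mellinConvergent_of_isBigO_rpow (a := 0) (b := -1) ?_
    (by simpa using H.isBigO_atTop) hz0 (by simpa using H.isBigO_zero) hz
  refine ContinuousOn.locallyIntegrableOn (fun x hx => ?_) measurableSet_Ioi
  exact (Complex.continuous_ofReal.continuousAt.comp (H.continuousAt x hx)).continuousWithinAt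

theorem setIntegral_Ioc_zero_h (H : IsTubeFunction V d κ h g lam) {s : ℂ}
    (hs : (d : ℝ) - 1 < s.re) :
    ∫ t in Set.Ioc 0 h, (t : ℂ) ^ (s - d - 1) • (V t : ℂ) =
      ∑ i ∈ Finset.range d, (h : ℂ) ^ (s - i) / (s - i) * (κ i : ℂ) := by
  have hre : ∀ i ∈ Finset.range d, -1 < (s - i - 1).re := by
    intro i hi
    have hid : (i : ℝ) + 1 ≤ d := by exact_mod_cast Finset.mem_range.1 hi
    simp only [Complex.sub_re, Complex.natCast_re, Complex.one_re]
    linarith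
  calc ∫ t in Set.Ioc 0 h, (t : ℂ) ^ (s - d - 1) • (V t : ℂ)
      = ∫ t in (0 : ℝ)..h, ∑ i ∈ Finset.range d, (t : ℂ) ^ (s - i - 1) * (κ i : ℂ) := by
        rw [intervalIntegral.integral_of_le H.h_pos.le, integral_Ioc_eq_integral_Ioo,
          integral_Ioc_eq_integral_Ioo]
        refine setIntegral_congr_fun measurableSet_Ioo fun t ht => ?_
        have ht0 : (t : ℂ) ≠ 0 := by exact_mod_cast ht.1.ne'
        simp only [H.eq_sum t ht.1 ht.2, Complex.ofReal_sum, smul_eq_mul, Finset.mul_sum]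
        refine Finset.sum_congr rfl fun i hi => ?_
        rw [Complex.ofReal_mul, Complex.ofReal_pow, mul_comm (κ i : ℂ), ← mul_assoc,
          ← Complex.cpow_natCast, ← Complex.cpow_add _ _ ht0,
          Nat.cast_sub (Finset.mem_range.1 hi).le]
        congr 2
        ring
    _ = ∑ i ∈ Finset.range d, ∫ t in (0 : ℝ)..h, (t : ℂ) ^ (s - i - 1) * (κ i : ℂ) :=
        intervalIntegral.integral_finsetSum fun i hi =>
          (intervalIntegral.intervalIntegrable_cpow' (hre i hi)).mul_const _
    _ = ∑ i ∈ Finset.range d, (h : ℂ) ^ (s - i) / (s - i) * (κ i : ℂ) := by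
        refine Finset.sum_congr rfl fun i hi => ?_
        have hsi : s - i ≠ 0 := fun h0 => by simpa [h0] using hre i hi
        rw [intervalIntegral.integral_mul_const, integral_cpow (Or.inl (hre i hi)),
          sub_add_cancel, Complex.ofReal_zero, Complex.zero_cpow hsi, sub_zero]

theorem setIntegral_Ioc_h_g (H : IsTubeFunction V d κ h g lam) (s : ℂ) :
    ∫ t in Set.Ioc h g, (t : ℂ) ^ (s - d - 1) • (V t : ℂ) = Lam d h g lam s := by
  rw [Lam, intervalIntegral.integral_of_le H.h_lt_g.le]
  refine setIntegral_congr_fun measurableSet_Ioc fun t ht => ?_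
  simp only [H.eq_lam t ht.1.le ht.2, smul_eq_mul]

theorem setIntegral_Ioi_g (H : IsTubeFunction V d κ h g lam) {s : ℂ} (hs : s.re < d) :
    ∫ t in Set.Ioi g, (t : ℂ) ^ (s - d - 1) • (V t : ℂ) =
      (g : ℂ) ^ (s - d) / (s - d) * (κ d : ℂ) := by
  have hre : (s - d - 1).re < -1 := by
    simp only [Complex.sub_re, Complex.natCast_re, Complex.one_re]
    linarith
  calc ∫ t in Set.Ioi g, (t : ℂ) ^ (s - d - 1) • (V t : ℂ)
      = ∫ t in Set.Ioi g, (t : ℂ) ^ (s - d - 1) * ((-κ d : ℝ) : ℂ) := by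
        refine setIntegral_congr_fun measurableSet_Ioi fun t ht => ?_
        simp only [H.eq_const t (Set.mem_Ioi.1 ht).le, smul_eq_mul]
    _ = (g : ℂ) ^ (s - d) / (s - d) * (κ d : ℂ) := by
        rw [integral_mul_const, integral_Ioi_cpow_of_lt hre (H.h_pos.trans H.h_lt_g),
          sub_add_cancel]
        push_cast
        ring

theorem mellin_eq_tubeTransform (H : IsTubeFunction V d κ h g lam) {s : ℂ}
    (hs : (d : ℝ) - 1 < s.re) (hsd : s.re < d) :
    mellin (fun x => (V x : ℂ)) (s - d) = tubeTransform d κ h g lam s := by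
  have hconv : IntegrableOn (fun t : ℝ => (t : ℂ) ^ (s - d - 1) • (V t : ℂ)) (Set.Ioi 0) :=
    H.mellinConvergent (z := s - d) (by simp; linarith) (by simp; linarith)
  have hg_pos := H.h_pos.trans H.h_lt_g
  rw [mellin, ← Set.Ioc_union_Ioi_eq_Ioi hg_pos.le,
    setIntegral_union Set.Ioc_disjoint_Ioi_same measurableSet_Ioi
      (hconv.mono_set Set.Ioc_subset_Ioi_self) (hconv.mono_set (Set.Ioi_subset_Ioi hg_pos.le)),
    ← Set.Ioc_union_Ioc_eq_Ioc H.h_pos.le H.h_lt_g.le,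
    setIntegral_union (Set.Ioc_disjoint_Ioc_of_le le_rfl) measurableSet_Ioc
      (hconv.mono_set Set.Ioc_subset_Ioi_self)
      (hconv.mono_set (Set.Ioc_subset_Ioi_self.trans (Set.Ioi_subset_Ioi H.h_pos.le))),
    H.setIntegral_Ioc_zero_h hs, H.setIntegral_Ioc_h_g, H.setIntegral_Ioi_g hsd, tubeTransform,
    add_right_comm]

theorem integrable_tubeTransform_vertical (H : IsTubeFunction V d κ h g lam) {c : ℝ}
    (hc : ∀ i ≤ d, c ≠ (i : ℕ)) :
    Integrable fun t : ℝ => tubeTransform d κ h g lam (c + t * Complex.I) := by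
  obtain ⟨K, hK⟩ := H.piecewise.exists_abs_deriv_le
  have hne : ∀ i ≤ d, ∀ t : ℝ, (c + t * Complex.I : ℂ) ≠ (i : ℕ) := fun i hi t heq =>
    hc i hi (by simpa using congrArg Complex.re heq)
  have hterm : ∀ i ∈ Finset.range d, MemLp (fun t : ℝ => (h : ℂ) ^ (c + t * Complex.I - i : ℂ) /
      (c + t * Complex.I - i) * ((κ i : ℂ) * (i - d))) 2 := by
    intro i hi
    have hinv := memLp_two_inv_vertical (hc i (Finset.mem_range.1 hi).le)
    refine hinv.of_le_mul (c := h ^ (c - i) * ‖(κ i : ℂ) * (i - d)‖)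
      (Measurable.aestronglyMeasurable (by fun_prop)) (Eventually.of_forall fun t => le_of_eq ?_)
    rw [norm_mul, norm_div, norm_inv, Complex.ofReal_natCast,
      ← norm_cpow_vertical H.h_pos c i t, Complex.ofReal_natCast]
    ring
  have hnum : MemLp (fun t : ℝ => ∑ i ∈ Finset.range d, (h : ℂ) ^ (c + t * Complex.I - i : ℂ) /
      (c + t * Complex.I - i) * ((κ i : ℂ) * (i - d)) -
        Lam d h g (deriv lam) (c + t * Complex.I + 1)) 2 := by
    have hLam := memLp_two_Lam_vertical (d := d) H.h_pos H.h_lt_g.le (measurable_deriv lam) hK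
      (c + 1)
    refine (memLp_finsetSum _ hterm).sub ?_
    simpa only [Complex.ofReal_add, Complex.ofReal_one, add_right_comm] using hLam
  refine ((memLp_two_inv_vertical (hc d le_rfl)).integrable_mul hnum).congr
    (Eventually.of_forall fun t => ?_)
  have hsd := sub_ne_zero.2 (hne d le_rfl t)
  simp only [Pi.mul_apply, ← H.sub_mul_tubeTransform fun i hi => hne i hi t]
  exact inv_mul_cancel_left₀ hsd _

theorem eq_integral_tubeTransform (H : IsTubeFunction V d κ h g lam) {c : ℝ}
    (hdc : (d : ℝ) - 1 < c) (hcd : c < d) {x : ℝ} (hx : 0 < x) :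
    (V x : ℂ) = (1 / (2 * Real.pi) : ℝ) * ∫ t : ℝ, (x : ℂ) ^ (d - (c + t * Complex.I)) *
      tubeTransform d κ h g lam (c + t * Complex.I) := by
  have hexp : ∀ t : ℝ, ((c - d : ℝ) + t * Complex.I : ℂ) = c + t * Complex.I - d := by
    intro t
    push_cast
    ring
  have hmellin : ∀ t : ℝ, mellin (fun x => (V x : ℂ)) ((c - d : ℝ) + t * Complex.I) =
      tubeTransform d κ h g lam (c + t * Complex.I) := by
    intro t
    rw [hexp, H.mellin_eq_tubeTransform (by simpa using hdc) (by simpa using hcd)]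
  rw [← mellinInv_mellin_eq (c - d) (fun x => (V x : ℂ)) hx
    (H.mellinConvergent (by simp; linarith) (by simp; linarith))
    (by simpa only [Complex.VerticalIntegrable, hmellin] using
      H.integrable_tubeTransform_vertical fun i _ => ne_natCast_of_sub_one_lt_of_lt hdc hcd i)
    (Complex.continuous_ofReal.continuousAt.comp (H.continuousAt x hx)),
    mellinInv, Complex.real_smul]
  simp only [hmellin, smul_eq_mul]
  simp only [hexp, neg_sub]

end IsTubeFunction

/-! ### Polar parts and residues -/

/-- The polar part `∑ₖ aₖ (z - ω)^{-(k+1)}`, with the coefficients `aₖ` of a polynomial `P`, so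
that `P.coeff 0` is its residue at `ω`. -/
noncomputable def polarPart (P : Polynomial ℂ) (ω z : ℂ) : ℂ :=
  (z - ω)⁻¹ * P.eval (z - ω)⁻¹

section PolarPart

variable {f A B : ℂ → ℂ} {P : Polynomial ℂ} {ω z : ℂ}

theorem analyticAt_polarPart (hz : z ≠ ω) (P : Polynomial ℂ) :
    AnalyticAt ℂ (polarPart P ω) z := by
  have hinv : AnalyticAt ℂ (fun z => (z - ω)⁻¹) z :=
    (analyticAt_id.sub analyticAt_const).inv (sub_ne_zero.2 hz)
  exact hinv.mul (hinv.aeval_polynomial P)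

theorem exists_hasDerivAt_polarPart_sub (P : Polynomial ℂ) (ω : ℂ) :
    ∃ F : ℂ → ℂ, ∀ z ≠ ω, HasDerivAt F (polarPart P ω z - P.coeff 0 * (z - ω)⁻¹) z := by
  induction P using Polynomial.induction_on' with
  | add P Q hP hQ =>
    obtain ⟨F, hF⟩ := hP
    obtain ⟨G, hG⟩ := hQ
    refine ⟨F + G, fun z hz => ((hF z hz).add (hG z hz)).congr_deriv ?_⟩
    simp only [polarPart, Polynomial.eval_add, Polynomial.coeff_add]
    ring
  | monomial n a =>
    cases n with
    | zero => exact ⟨0, fun z _ => by simp [polarPart, mul_comm, hasDerivAt_zero]⟩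
    | succ n =>
      refine ⟨fun z => -(a / (n + 1)) * (z - ω)⁻¹ ^ (n + 1), fun z hz => ?_⟩
      have hz0 := sub_ne_zero.2 hz
      have hn : (n : ℂ) + 1 ≠ 0 := by exact_mod_cast n.succ_ne_zero
      have hinv : HasDerivAt (fun z => (z - ω)⁻¹) (-1 / (z - ω) ^ 2) z :=
        ((hasDerivAt_id z).sub_const ω).fun_inv hz0
      refine ((hinv.pow (n + 1)).const_mul (-(a / (n + 1)))).congr_deriv ?_
      simp only [polarPart, Polynomial.eval_monomial, Polynomial.coeff_monomial,
        Nat.succ_ne_zero, if_false, Nat.cast_add, Nat.cast_one, Nat.add_sub_cancel, inv_pow]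
      field_simp
      ring

theorem circleIntegral_polarPart (P : Polynomial ℂ) (ω : ℂ) {ρ : ℝ} (hρ : 0 < ρ) :
    ∮ z in C(ω, ρ), polarPart P ω z = 2 * Real.pi * Complex.I * P.coeff 0 := by
  obtain ⟨F, hF⟩ := exists_hasDerivAt_polarPart_sub P ω
  have hne : ∀ z ∈ Metric.sphere ω ρ, z ≠ ω := fun z hz => Metric.ne_of_mem_sphere hz hρ.ne'
  have hpolar : CircleIntegrable (polarPart P ω) ω ρ :=
    ContinuousOn.circleIntegrable hρ.le fun z hz =>
      (analyticAt_polarPart (hne z hz) P).continuousAt.continuousWithinAt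
  have hinv : CircleIntegrable (fun z => P.coeff 0 * (z - ω)⁻¹) ω ρ :=
    ContinuousOn.circleIntegrable hρ.le (continuousOn_const.mul
      ((continuousOn_id.sub continuousOn_const).inv₀ fun z hz => sub_ne_zero.2 (hne z hz)))
  have hzero := circleIntegral.integral_eq_zero_of_hasDerivWithinAt hρ.le
    fun z hz => (hF z (hne z hz)).hasDerivWithinAt
  rw [circleIntegral.integral_sub hpolar hinv, sub_eq_zero] at hzero
  rw [hzero, circleIntegral.integral_const_mul, circleIntegral.integral_sub_center_inv ω hρ.ne',
    mul_comm]

theorem exists_mul_inv_pow_eq_polarPart_add (hA : AnalyticAt ℂ A ω) (n : ℕ) :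
    ∃ (P : Polynomial ℂ) (B : ℂ → ℂ), AnalyticAt ℂ B ω ∧
      ∀ z ≠ ω, A z * (z - ω)⁻¹ ^ n = polarPart P ω z + B z := by
  induction n generalizing A with
  | zero => exact ⟨0, A, hA, by simp [polarPart]⟩
  | succ n ih =>
    obtain ⟨p, hp⟩ := hA
    obtain ⟨P, B, hB, hPB⟩ := ih ⟨_, hp.has_fpower_series_dslope_fslope⟩
    refine ⟨Polynomial.monomial n (A ω) + P, B, hB, fun z hz => ?_⟩
    have hz0 : z - ω ≠ 0 := sub_ne_zero.2 hz
    have hAz : A z = A ω + (z - ω) * dslope A ω z := by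
      rw [← smul_eq_mul, sub_smul_dslope]
      ring
    have hP : polarPart (Polynomial.monomial n (A ω) + P) ω z =
        A ω * (z - ω)⁻¹ ^ (n + 1) + polarPart P ω z := by
      simp only [polarPart, Polynomial.eval_add, Polynomial.eval_monomial]
      ring
    rw [hP, add_assoc, ← hPB z hz, hAz, pow_succ]
    field_simp

theorem exists_eq_polarPart_add (hf : MeromorphicAt f ω) :
    ∃ (P : Polynomial ℂ) (B : ℂ → ℂ), AnalyticAt ℂ B ω ∧
      ∀ z ≠ ω, f z = polarPart P ω z + B z := by
  obtain ⟨n, hn⟩ := hf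
  obtain ⟨P, B, hB, hPB⟩ := exists_mul_inv_pow_eq_polarPart_add hn n
  refine ⟨P, B, hB, fun z hz => ?_⟩
  rw [← hPB z hz, smul_eq_mul, inv_pow, mul_comm, inv_mul_cancel_left₀]
  exact pow_ne_zero n (sub_ne_zero.2 hz)

theorem residue_eq_coeff_zero (hB : AnalyticAt ℂ B ω)
    (hf : f =ᶠ[𝓝[≠] ω] fun z => polarPart P ω z + B z) : residue f ω = P.coeff 0 := by
  obtain ⟨δ, hδ, hball⟩ := Metric.eventually_nhds_iff_ball.1
    (hB.eventually_analyticAt.and (eventually_nhdsWithin_iff.1 hf))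
  refine Tendsto.limUnder_eq (tendsto_const_nhds.congr' ?_)
  filter_upwards [Ioo_mem_nhdsGT hδ] with ρ ⟨hρ, hρδ⟩
  have hclosed := Metric.closedBall_subset_ball hρδ (x := ω)
  have hsphere := Metric.sphere_subset_closedBall.trans hclosed
  have hne : ∀ z ∈ Metric.sphere ω ρ, z ≠ ω := fun z hz => Metric.ne_of_mem_sphere hz hρ.ne'
  have hBcont : ContinuousOn B (Metric.closedBall ω ρ) := fun z hz =>
    (hball z (hclosed hz)).1.continuousAt.continuousWithinAt
  have hpolar : CircleIntegrable (polarPart P ω) ω ρ :=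
    ContinuousOn.circleIntegrable hρ.le fun z hz =>
      (analyticAt_polarPart (hne z hz) P).continuousAt.continuousWithinAt
  have hBzero : ∮ z in C(ω, ρ), B z = 0 :=
    Complex.circleIntegral_eq_zero_of_differentiable_on_off_countable hρ.le Set.countable_empty
      hBcont fun z hz => (hball z (hclosed (Metric.ball_subset_closedBall hz.1))).1.differentiableAt
  rw [circleIntegral.integral_congr hρ.le fun z hz => (hball z (hsphere hz)).2 (hne z hz),
    circleIntegral.integral_add hpolar
      (hBcont.mono Metric.sphere_subset_closedBall |>.circleIntegrable hρ.le),
    hBzero, add_zero, circleIntegral_polarPart P ω hρ]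
  field_simp

theorem residue_eq_residue_of_eventuallyEq_add {F : ℂ → ℂ} (hf : MeromorphicAt f ω)
    (hA : AnalyticAt ℂ A ω) (hF : F =ᶠ[𝓝[≠] ω] fun z => f z + A z) :
    residue F ω = residue f ω := by
  obtain ⟨P, B, hB, hfP⟩ := exists_eq_polarPart_add hf
  have hfP' : f =ᶠ[𝓝[≠] ω] fun z => polarPart P ω z + B z := by
    filter_upwards [self_mem_nhdsWithin] with z hz using hfP z hz
  rw [residue_eq_coeff_zero hB hfP', residue_eq_coeff_zero (hB.add hA)]
  filter_upwards [hF, hfP'] with z hFz hfz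
  rw [hFz, hfz, Pi.add_apply, add_assoc]

theorem exists_eq_polarPart_add_and_residue_eq (hf : MeromorphicAt f ω) :
    ∃ (P : Polynomial ℂ) (B : ℂ → ℂ), P.coeff 0 = residue f ω ∧
      (∀ z ≠ ω, f z = polarPart P ω z + B z) ∧ DifferentiableAt ℂ B ω ∧
      (∀ z ≠ ω, DifferentiableAt ℂ f z → DifferentiableAt ℂ B z) ∧
      ∀ z ≠ ω, MeromorphicAt f z → MeromorphicAt B z ∧ residue B z = residue f z := by
  obtain ⟨P, B, hB, hfB⟩ := exists_eq_polarPart_add hf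
  have hP : ∀ z ≠ ω, AnalyticAt ℂ (fun z => -polarPart P ω z) z := fun z hz =>
    (analyticAt_polarPart hz P).neg
  have hB_eq : ∀ z ≠ ω, B =ᶠ[𝓝 z] fun z => f z + -polarPart P ω z := by
    intro z hz
    filter_upwards [isOpen_ne.mem_nhds hz] with y hy
    rw [hfB y hy]
    ring
  refine ⟨P, B, (residue_eq_coeff_zero hB ?_).symm, hfB, hB.differentiableAt,
    fun z hz hfz => ?_, fun z hz hfz => ⟨?_, ?_⟩⟩
  · filter_upwards [self_mem_nhdsWithin] with z hz using hfB z hz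
  · exact (hfz.add (hP z hz).differentiableAt).congr_of_eventuallyEq (hB_eq z hz)
  · exact (hfz.add (hP z hz).meromorphicAt).congr
      ((hB_eq z hz).symm.filter_mono nhdsWithin_le_nhds)
  · exact residue_eq_residue_of_eventuallyEq_add hfz (hP z hz)
      ((hB_eq z hz).filter_mono nhdsWithin_le_nhds)

end PolarPart

/-! ### The residue theorem for rectangles -/

/-- The boundary of the rectangle `[a, b] × [m, M]`. -/
def rectBoundary (a b m M : ℝ) : Set ℂ :=
  (Set.Icc a b ×ℂ Set.Icc m M) \ (Set.Ioo a b ×ℂ Set.Ioo m M)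

/-- The counterclockwise integral over the boundary of the rectangle `[a, b] × [m, M]`. -/
noncomputable def rectIntegral (f : ℂ → ℂ) (a b m M : ℝ) : ℂ :=
  (∫ x in a..b, f (x + m * Complex.I)) - (∫ x in a..b, f (x + M * Complex.I)) +
    Complex.I * (∫ y in m..M, f (b + y * Complex.I)) -
    Complex.I * ∫ y in m..M, f (a + y * Complex.I)

section Rectangle

variable {a b m M x y : ℝ} {f f₁ f₂ F : ℂ → ℂ} {ω : ℂ}

theorem horizontal_mem_rectBoundary (hab : a ≤ b) (hm : m ≤ M) (hx : x ∈ Set.uIcc a b)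
    (hy : y = m ∨ y = M) : (x + y * Complex.I : ℂ) ∈ rectBoundary a b m M := by
  rw [Set.uIcc_of_le hab] at hx
  rcases hy with rfl | rfl <;> simp [rectBoundary, Complex.mem_reProdIm, hx.1, hx.2, hm]

theorem vertical_mem_rectBoundary (hab : a ≤ b) (hm : m ≤ M) (hx : x = a ∨ x = b)
    (hy : y ∈ Set.uIcc m M) : (x + y * Complex.I : ℂ) ∈ rectBoundary a b m M := by
  rw [Set.uIcc_of_le hm] at hy
  rcases hx with rfl | rfl <;> simp [rectBoundary, Complex.mem_reProdIm, hy.1, hy.2, hab]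

theorem ne_of_mem_rectBoundary {z : ℂ} (hω : ω ∈ Set.Ioo a b ×ℂ Set.Ioo m M)
    (hz : z ∈ rectBoundary a b m M) : z ≠ ω := by
  rintro rfl
  exact hz.2 hω

theorem intervalIntegrable_horizontal (hf : ContinuousOn f (rectBoundary a b m M)) (hab : a ≤ b)
    (hm : m ≤ M) (hy : y = m ∨ y = M) :
    IntervalIntegrable (fun x : ℝ => f (x + y * Complex.I)) volume a b :=
  (hf.comp (by fun_prop) fun _ hx =>
    horizontal_mem_rectBoundary hab hm hx hy).intervalIntegrable

theorem intervalIntegrable_vertical (hf : ContinuousOn f (rectBoundary a b m M)) (hab : a ≤ b)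
    (hm : m ≤ M) (hx : x = a ∨ x = b) :
    IntervalIntegrable (fun y : ℝ => f (x + y * Complex.I)) volume m M :=
  (hf.comp (by fun_prop) fun _ hy =>
    vertical_mem_rectBoundary hab hm hx hy).intervalIntegrable

theorem rectIntegral_add (hab : a ≤ b) (hm : m ≤ M) (h₁ : ContinuousOn f₁ (rectBoundary a b m M))
    (h₂ : ContinuousOn f₂ (rectBoundary a b m M)) :
    rectIntegral (fun z => f₁ z + f₂ z) a b m M =
      rectIntegral f₁ a b m M + rectIntegral f₂ a b m M := by
  have hhorizontal : ∀ {y : ℝ}, y = m ∨ y = M → _ := fun hy => intervalIntegral.integral_add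
    (intervalIntegrable_horizontal h₁ hab hm hy) (intervalIntegrable_horizontal h₂ hab hm hy)
  have hvertical : ∀ {x : ℝ}, x = a ∨ x = b → _ := fun hx => intervalIntegral.integral_add
    (intervalIntegrable_vertical h₁ hab hm hx) (intervalIntegrable_vertical h₂ hab hm hx)
  unfold rectIntegral
  rw [hhorizontal (Or.inl rfl), hhorizontal (Or.inr rfl), hvertical (Or.inl rfl),
    hvertical (Or.inr rfl)]
  ring

theorem rectIntegral_congr (hab : a ≤ b) (hm : m ≤ M)
    (h : Set.EqOn f₁ f₂ (rectBoundary a b m M)) :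
    rectIntegral f₁ a b m M = rectIntegral f₂ a b m M := by
  unfold rectIntegral
  rw [intervalIntegral.integral_congr fun x hx =>
      h (horizontal_mem_rectBoundary hab hm hx (Or.inl rfl)),
    intervalIntegral.integral_congr fun x hx =>
      h (horizontal_mem_rectBoundary hab hm hx (Or.inr rfl)),
    intervalIntegral.integral_congr fun y hy =>
      h (vertical_mem_rectBoundary hab hm (Or.inl rfl) hy),
    intervalIntegral.integral_congr fun y hy =>
      h (vertical_mem_rectBoundary hab hm (Or.inr rfl) hy)]

theorem rectIntegral_const_mul (c : ℂ) (f : ℂ → ℂ) :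
    rectIntegral (fun z => c * f z) a b m M = c * rectIntegral f a b m M := by
  simp only [rectIntegral, intervalIntegral.integral_const_mul]
  ring

theorem integral_horizontal_eq_sub
    (hF : ∀ x ∈ Set.uIcc a b, HasDerivAt F (f (x + y * Complex.I)) (x + y * Complex.I))
    (hf : IntervalIntegrable (fun x : ℝ => f (x + y * Complex.I)) volume a b) :
    ∫ x in a..b, f (x + y * Complex.I) = F (b + y * Complex.I) - F (a + y * Complex.I) := by
  refine intervalIntegral.integral_eq_sub_of_hasDerivAt
    (f := fun x : ℝ => F (x + y * Complex.I)) (fun x hx => ?_) hf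
  exact ((hF x hx).comp_add_const (x : ℂ) (y * Complex.I)).comp_ofReal

theorem integral_vertical_eq_sub
    (hF : ∀ y ∈ Set.uIcc m M, HasDerivAt F (f (x + y * Complex.I)) (x + y * Complex.I))
    (hf : IntervalIntegrable (fun y : ℝ => f (x + y * Complex.I)) volume m M) :
    Complex.I * ∫ y in m..M, f (x + y * Complex.I) =
      F (x + M * Complex.I) - F (x + m * Complex.I) := by
  rw [← intervalIntegral.integral_const_mul]
  refine intervalIntegral.integral_eq_sub_of_hasDerivAt
    (f := fun y : ℝ => F (x + y * Complex.I)) (fun y hy => ?_) (hf.const_mul _)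
  have hline : HasDerivAt (fun y : ℂ => x + y * Complex.I) Complex.I (y : ℂ) := by
    simpa using ((hasDerivAt_id (y : ℂ)).mul_const Complex.I).const_add (x : ℂ)
  simpa [Function.comp_def, mul_comm] using
    (HasDerivAt.comp (y : ℂ) (hF y hy) hline).comp_ofReal

theorem rectIntegral_eq_zero_of_hasDerivAt (hab : a ≤ b) (hm : m ≤ M)
    (hf : ContinuousOn f (rectBoundary a b m M))
    (hF : ∀ z ∈ rectBoundary a b m M, HasDerivAt F (f z) z) : rectIntegral f a b m M = 0 := by
  have hhorizontal : ∀ {y : ℝ}, y = m ∨ y = M → _ := fun hy => integral_horizontal_eq_sub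
    (fun x hx => hF _ (horizontal_mem_rectBoundary hab hm hx hy))
    (intervalIntegrable_horizontal hf hab hm hy)
  have hvertical : ∀ {x : ℝ}, x = a ∨ x = b → _ := fun hx => integral_vertical_eq_sub
    (fun y hy => hF _ (vertical_mem_rectBoundary hab hm hx hy))
    (intervalIntegrable_vertical hf hab hm hx)
  unfold rectIntegral
  rw [hhorizontal (Or.inl rfl), hhorizontal (Or.inr rfl), hvertical (Or.inl rfl),
    hvertical (Or.inr rfl)]
  ring

theorem rectIntegral_eq_zero_of_differentiableAt (hab : a ≤ b) (hm : m ≤ M)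
    (hf : ∀ z ∈ Set.Icc a b ×ℂ Set.Icc m M, DifferentiableAt ℂ f z) :
    rectIntegral f a b m M = 0 := by
  simpa [rectIntegral] using Complex.integral_boundary_rect_eq_zero_of_differentiableOn f
    (a + m * Complex.I) (b + M * Complex.I) fun z hz =>
      (hf z (by simpa [Set.uIcc_of_le hab, Set.uIcc_of_le hm] using hz)).differentiableWithinAt

theorem log_sub_log_neg_of_im_pos {z : ℂ} (hz : 0 < z.im) :
    Complex.log z - Complex.log (-z) = Real.pi * Complex.I := by
  rw [Complex.log, Complex.log, norm_neg, Complex.arg_neg_eq_arg_sub_pi_of_im_pos hz]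
  push_cast
  ring

theorem log_sub_log_neg_of_im_neg {z : ℂ} (hz : z.im < 0) :
    Complex.log z - Complex.log (-z) = -(Real.pi * Complex.I) := by
  rw [← neg_eq_iff_eq_neg, neg_sub, ← log_sub_log_neg_of_im_pos (z := -z) (by simpa using hz),
    neg_neg]

-- `log (z - ω)` is a primitive on three sides and `log (ω - z)` on the left one, where the cut of
-- the first lies.
theorem rectIntegral_inv (hω : ω ∈ Set.Ioo a b ×ℂ Set.Ioo m M) :
    rectIntegral (fun z => (z - ω)⁻¹) a b m M = 2 * Real.pi * Complex.I := by
  obtain ⟨hre, him⟩ := Complex.mem_reProdIm.1 hω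
  have hab : a ≤ b := (hre.1.trans hre.2).le
  have hm : m ≤ M := (him.1.trans him.2).le
  have hcont : ContinuousOn (fun z => (z - ω)⁻¹) (rectBoundary a b m M) :=
    (continuousOn_id.sub continuousOn_const).inv₀ fun z hz =>
      sub_ne_zero.2 (ne_of_mem_rectBoundary hω hz)
  have hlog : ∀ z : ℂ, z - ω ∈ Complex.slitPlane →
      HasDerivAt (fun z => Complex.log (z - ω)) ((z - ω)⁻¹) z := fun z hz => by
    simpa using ((hasDerivAt_id z).sub_const ω).clog hz
  have hlog_neg : ∀ z : ℂ, -(z - ω) ∈ Complex.slitPlane →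
      HasDerivAt (fun z => Complex.log (-(z - ω))) ((z - ω)⁻¹) z := fun z hz =>
    (((hasDerivAt_id z).sub_const ω).fun_neg.clog hz).congr_deriv (by
      simp only [id, div_neg, neg_div, neg_neg, one_div])
  unfold rectIntegral
  rw [integral_horizontal_eq_sub (f := fun z => (z - ω)⁻¹)
      (fun x _ => hlog _ (Or.inr (by simpa [sub_eq_zero] using him.1.ne)))
      (intervalIntegrable_horizontal hcont hab hm (Or.inl rfl)),
    integral_horizontal_eq_sub (f := fun z => (z - ω)⁻¹)
      (fun x _ => hlog _ (Or.inr (by simpa [sub_eq_zero] using him.2.ne')))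
      (intervalIntegrable_horizontal hcont hab hm (Or.inr rfl)),
    integral_vertical_eq_sub (f := fun z => (z - ω)⁻¹)
      (fun y _ => hlog _ (Or.inl (by simpa using hre.2)))
      (intervalIntegrable_vertical hcont hab hm (Or.inr rfl)),
    integral_vertical_eq_sub (f := fun z => (z - ω)⁻¹)
      (fun y _ => hlog_neg _ (Or.inl (by simpa using hre.1)))
      (intervalIntegrable_vertical hcont hab hm (Or.inl rfl))]
  have htop := log_sub_log_neg_of_im_pos (z := a + M * Complex.I - ω) (by simpa using him.2)
  have hbot := log_sub_log_neg_of_im_neg (z := a + m * Complex.I - ω) (by simpa using him.1)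
  linear_combination htop - hbot

theorem rectIntegral_polarPart (hω : ω ∈ Set.Ioo a b ×ℂ Set.Ioo m M) (P : Polynomial ℂ) :
    rectIntegral (polarPart P ω) a b m M = 2 * Real.pi * Complex.I * P.coeff 0 := by
  obtain ⟨hre, him⟩ := Complex.mem_reProdIm.1 hω
  have hab : a ≤ b := (hre.1.trans hre.2).le
  have hm : m ≤ M := (him.1.trans him.2).le
  obtain ⟨F, hF⟩ := exists_hasDerivAt_polarPart_sub P ω
  have hne : ∀ z ∈ rectBoundary a b m M, z ≠ ω := fun z => ne_of_mem_rectBoundary hω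
  have hinv : ContinuousOn (fun z => P.coeff 0 * (z - ω)⁻¹) (rectBoundary a b m M) :=
    continuousOn_const.mul ((continuousOn_id.sub continuousOn_const).inv₀ fun z hz =>
      sub_ne_zero.2 (hne z hz))
  have hrest : ContinuousOn (fun z => polarPart P ω z - P.coeff 0 * (z - ω)⁻¹)
      (rectBoundary a b m M) :=
    ContinuousOn.sub (fun z hz =>
      (analyticAt_polarPart (hne z hz) P).continuousAt.continuousWithinAt) hinv
  rw [rectIntegral_congr hab hm fun z _ =>
      (add_sub_cancel (P.coeff 0 * (z - ω)⁻¹) (polarPart P ω z)).symm,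
    rectIntegral_add hab hm hinv hrest,
    rectIntegral_eq_zero_of_hasDerivAt hab hm hrest fun z hz => hF z (hne z hz),
    rectIntegral_const_mul, rectIntegral_inv hω]
  ring

-- Induction on the number of poles, subtracting one polar part at a time.
theorem rectIntegral_eq_sum_residue (hab : a ≤ b) (hm : m ≤ M) (S : Finset ℂ)
    (hS : ∀ ω ∈ S, ω ∈ Set.Ioo a b ×ℂ Set.Ioo m M) (hmer : ∀ ω ∈ S, MeromorphicAt f ω)
    (hf : ∀ z ∈ Set.Icc a b ×ℂ Set.Icc m M, z ∉ S → DifferentiableAt ℂ f z) :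
    rectIntegral f a b m M = 2 * Real.pi * Complex.I * ∑ ω ∈ S, residue f ω := by
  classical
  induction S using Finset.induction_on generalizing f with
  | empty => simpa using rectIntegral_eq_zero_of_differentiableAt hab hm (by simpa using hf)
  | insert ω S hωS ih =>
    simp only [Finset.forall_mem_insert] at hS hmer
    obtain ⟨P, B, hres, hfB, hB, hB_diff, hB_mer⟩ := exists_eq_polarPart_add_and_residue_eq hmer.1
    have hB_mer' : ∀ ω' ∈ S, MeromorphicAt B ω' ∧ residue B ω' = residue f ω' := fun ω' hω' =>
      hB_mer ω' (ne_of_mem_of_not_mem hω' hωS) (hmer.2 ω' hω')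
    have hB_diff' : ∀ z ∈ Set.Icc a b ×ℂ Set.Icc m M, z ∉ S → DifferentiableAt ℂ B z := by
      intro z hz hzS
      rcases eq_or_ne z ω with rfl | hzω
      · exact hB
      · exact hB_diff z hzω (hf z hz (by simp [hzω, hzS]))
    have hP_cont : ContinuousOn (polarPart P ω) (rectBoundary a b m M) := fun z hz =>
      (analyticAt_polarPart (ne_of_mem_rectBoundary hS.1 hz) P).continuousAt.continuousWithinAt
    have hB_cont : ContinuousOn B (rectBoundary a b m M) := fun z hz =>
      (hB_diff' z hz.1 fun hzS => hz.2 (hS.2 z hzS)).continuousAt.continuousWithinAt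
    rw [rectIntegral_congr hab hm fun z hz => hfB z (ne_of_mem_rectBoundary hS.1 hz),
      rectIntegral_add hab hm hP_cont hB_cont, rectIntegral_polarPart hS.1, hres,
      ih hS.2 (fun ω' hω' => (hB_mer' ω' hω').1) hB_diff', Finset.sum_insert hωS, mul_add,
      Finset.sum_congr rfl fun ω' hω' => (hB_mer' ω' hω').2]

end Rectangle

/-! ### Zeros of entire functions -/

section Entire

variable {E : Type*} [NormedAddCommGroup E] [NormedSpace ℂ E] [CompleteSpace E] {f : ℂ → E} {z₀ : ℂ}

theorem eventually_ne_zero_nhdsNE_of_differentiable (hf : Differentiable ℂ f) (hz₀ : f z₀ ≠ 0)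
    (z : ℂ) : ∀ᶠ w in 𝓝[≠] z, f w ≠ 0 := by
  have hana : AnalyticOnNhd ℂ f Set.univ := fun w _ => hf.analyticAt w
  by_contra hfreq
  exact hz₀ (hana.eqOn_zero_of_preconnected_of_frequently_eq_zero isPreconnected_univ
    (Set.mem_univ z) (by simpa using Filter.not_eventually.1 hfreq) (Set.mem_univ z₀))

theorem finite_zeros_of_isCompact (hf : Differentiable ℂ f) (hz₀ : f z₀ ≠ 0) {K : Set ℂ}
    (hK : IsCompact K) : {z ∈ K | f z = 0}.Finite := by
  by_contra hinf
  obtain ⟨z, -, hz⟩ := Set.Infinite.exists_accPt_of_subset_isCompact hinf hK fun z hz => hz.1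
  obtain ⟨w, hw, hw0⟩ := ((accPt_iff_frequently_nhdsNE.1 hz).and_eventually
    (eventually_ne_zero_nhdsNE_of_differentiable hf hz₀ z)).exists
  exact hw0 hw.2

theorem exists_pos_le_norm_on_horizontal_segment (hf : Differentiable ℂ f) (hz₀ : f z₀ ≠ 0)
    (a b : ℝ) {m M : ℝ} (hmM : m < M) :
    ∃ y ∈ Set.Icc m M, ∃ δ > 0, ∀ x ∈ Set.Icc a b, δ ≤ ‖f (x + y * Complex.I)‖ := by
  have hfin : {z ∈ Set.Icc a b ×ℂ Set.Icc m M | f z = 0}.Finite :=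
    finite_zeros_of_isCompact hf hz₀ (isCompact_Icc.reProdIm isCompact_Icc)
  obtain ⟨y, hy, hy_im⟩ := ((Set.Icc_infinite hmM).sdiff (hfin.image Complex.im)).nonempty
  have hne : ∀ x ∈ Set.Icc a b, 0 < ‖f (x + y * Complex.I)‖ := fun x hx =>
    norm_pos_iff.2 fun h0 => hy_im ⟨x + y * Complex.I, ⟨by simpa [Complex.mem_reProdIm] using
      ⟨hx, hy⟩, h0⟩, by simp⟩
  obtain ⟨δ, hδ, hle⟩ := isCompact_Icc.exists_forall_le' (f := fun x : ℝ => ‖f (x + y * Complex.I)‖)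
    (hf.continuous.comp (by fun_prop)).norm.continuousOn hne
  exact ⟨y, hy, δ, hδ, hle⟩

end Entire

theorem meromorphicOrderAt_inv_neg_iff {f : ℂ → ℂ} {z₀ : ℂ} (hf : Differentiable ℂ f)
    (hz₀ : f z₀ ≠ 0) (z : ℂ) : meromorphicOrderAt f⁻¹ z < 0 ↔ f z = 0 := by
  have htends : Tendsto f (𝓝[≠] z) (𝓝 (f z)) :=
    (hf.continuous.tendsto z).mono_left nhdsWithin_le_nhds
  rw [← tendsto_cobounded_iff_meromorphicOrderAt_neg (hf.analyticAt z).meromorphicAt.inv]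
  constructor
  · intro hpole
    by_contra hne
    exact (htends.inv₀ hne).not_tendsto (Metric.disjoint_nhds_cobounded _) hpole
  · intro h0
    exact Filter.tendsto_inv₀_nhdsNE_zero.comp (tendsto_nhdsWithin_iff.2
      ⟨h0 ▸ htends, eventually_ne_zero_nhdsNE_of_differentiable hf hz₀ z⟩)

/-! ### The denominator of the scaling zeta function -/

section ScalingDenom

variable {ι : Type*} [Fintype ι] {r : ι → ℝ} {D : ℝ}

/-- The exponential polynomial `1 - ∑ θ_j r_j^s`. The weights `θ_j` of modulus one arise from
vertical translations of the denominator of the scaling zeta function and from limits of these. -/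
noncomputable def weightedDenom (θ : ι → ℂ) (r : ι → ℝ) (s : ℂ) : ℂ :=
  1 - ∑ j, θ j * (r j : ℂ) ^ s

/-- The denominator `1 - ∑ r_j^s` of the scaling zeta function. -/
noncomputable def scalingDenom (r : ι → ℝ) (s : ℂ) : ℂ :=
  1 - ∑ j, (r j : ℂ) ^ s

theorem weightedDenom_one (r : ι → ℝ) : weightedDenom 1 r = scalingDenom r := by
  ext s
  simp [weightedDenom, scalingDenom]

theorem differentiable_weightedDenom (hr : ∀ j, 0 < r j) (θ : ι → ℂ) :
    Differentiable ℂ (weightedDenom θ r) := by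
  refine (differentiable_const _).sub (Differentiable.fun_sum fun j _ => ?_)
  exact (differentiable_id.const_cpow (Or.inl (by exact_mod_cast (hr j).ne'))).const_mul _

theorem differentiable_scalingDenom (hr : ∀ j, 0 < r j) : Differentiable ℂ (scalingDenom r) :=
  weightedDenom_one r ▸ differentiable_weightedDenom hr 1

theorem norm_sum_mul_cpow_le (hr : ∀ j, 0 < r j) (hr1 : ∀ j, r j < 1) (θ : ι → ℂ) {a : ℝ} {s : ℂ}
    (hs : a ≤ s.re) : ‖∑ j, θ j * (r j : ℂ) ^ s‖ ≤ ∑ j, ‖θ j‖ * r j ^ a := by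
  refine norm_sum_le_of_le _ fun j _ => ?_
  rw [norm_mul, Complex.norm_cpow_eq_rpow_re_of_pos (hr j)]
  exact mul_le_mul_of_nonneg_left (Real.rpow_le_rpow_of_exponent_ge (hr j) (hr1 j).le hs)
    (norm_nonneg _)

theorem le_norm_weightedDenom (hr : ∀ j, 0 < r j) (hr1 : ∀ j, r j < 1) {θ : ι → ℂ}
    (hθ : ∀ j, ‖θ j‖ ≤ 1) {c : ℝ} {s : ℂ} (hs : c ≤ s.re) :
    1 - ∑ j, r j ^ c ≤ ‖weightedDenom θ r s‖ := by
  have hsum : ‖∑ j, θ j * (r j : ℂ) ^ s‖ ≤ ∑ j, r j ^ c :=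
    (norm_sum_mul_cpow_le hr hr1 θ hs).trans <| Finset.sum_le_sum fun j _ =>
      mul_le_of_le_one_left (Real.rpow_nonneg (hr j).le c) (hθ j)
  have htri := norm_sub_norm_le (1 : ℂ) (∑ j, θ j * (r j : ℂ) ^ s)
  rw [norm_one] at htri
  exact (sub_le_sub_left hsum 1).trans htri

theorem le_norm_scalingDenom (hr : ∀ j, 0 < r j) (hr1 : ∀ j, r j < 1) {c : ℝ} {s : ℂ}
    (hs : c ≤ s.re) : 1 - ∑ j, r j ^ c ≤ ‖scalingDenom r s‖ :=
  weightedDenom_one r ▸ le_norm_weightedDenom hr hr1 (by simp) hs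

theorem nonempty_of_sum_rpow_eq_one (hD : ∑ j, r j ^ D = 1) : Nonempty ι := by
  by_contra hempty
  rw [not_nonempty_iff] at hempty
  simp at hD

theorem sum_rpow_lt_one (hr : ∀ j, 0 < r j) (hr1 : ∀ j, r j < 1) (hD : ∑ j, r j ^ D = 1) {c : ℝ}
    (hc : D < c) : ∑ j, r j ^ c < 1 := by
  have := nonempty_of_sum_rpow_eq_one hD
  rw [← hD]
  exact Finset.sum_lt_sum_of_nonempty Finset.univ_nonempty fun j _ =>
    Real.rpow_lt_rpow_of_exponent_gt (hr j) (hr1 j) hc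

theorem scalingDenom_ne_zero_of_lt_re (hr : ∀ j, 0 < r j) (hr1 : ∀ j, r j < 1)
    (hD : ∑ j, r j ^ D = 1) {s : ℂ} (hs : D < s.re) : scalingDenom r s ≠ 0 :=
  norm_pos_iff.1 <| (sub_pos.2 (sum_rpow_lt_one hr hr1 hD hs)).trans_le
    (le_norm_scalingDenom hr hr1 le_rfl)

theorem norm_scalingDenom_conj (hr : ∀ j, 0 < r j) (s : ℂ) :
    ‖scalingDenom r (starRingEnd ℂ s)‖ = ‖scalingDenom r s‖ := by
  have hconj : scalingDenom r (starRingEnd ℂ s) = starRingEnd ℂ (scalingDenom r s) := by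
    simp only [scalingDenom, map_sub, map_one, map_sum]
    congr! 2 with j
    rw [Complex.cpow_conj, Complex.conj_ofReal]
    rw [Complex.arg_ofReal_of_nonneg (hr j).le]
    exact Real.pi_ne_zero.symm
  rw [hconj, RCLike.norm_conj]

-- The sum of the terms with the smallest ratio dominates as `Re s → -∞`.
theorem le_norm_scalingDenom_left (hr : ∀ j, 0 < r j) (j₀ : ι) (s : ℂ) :
    r j₀ ^ s.re * (1 - ∑ j with r j ≠ r j₀, (r j / r j₀) ^ s.re) - 1 ≤ ‖scalingDenom r s‖ := by
  classical
  have hmin : r j₀ ^ s.re ≤ ‖∑ j with r j = r j₀, (r j : ℂ) ^ s‖ := by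
    have hcard : (1 : ℝ) ≤ Finset.card {j | r j = r j₀} := by
      exact_mod_cast Finset.card_pos.2 ⟨j₀, by simp⟩
    rw [Finset.sum_congr rfl fun j hj => by rw [(Finset.mem_filter.1 hj).2], Finset.sum_const,
      nsmul_eq_mul, norm_mul, Complex.norm_natCast, Complex.norm_cpow_eq_rpow_re_of_pos (hr j₀)]
    exact le_mul_of_one_le_left (Real.rpow_nonneg (hr j₀).le _) hcard
  have hrest : ‖∑ j with r j ≠ r j₀, (r j : ℂ) ^ s‖ ≤
      r j₀ ^ s.re * ∑ j with r j ≠ r j₀, (r j / r j₀) ^ s.re := by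
    rw [Finset.mul_sum]
    refine norm_sum_le_of_le _ fun j _ => ?_
    rw [Complex.norm_cpow_eq_rpow_re_of_pos (hr j), Real.div_rpow (hr j).le (hr j₀).le,
      mul_div_cancel₀ _ (Real.rpow_pos_of_pos (hr j₀) _).ne']
  have hsplit : ∑ j with r j = r j₀, (r j : ℂ) ^ s =
      1 - (scalingDenom r s + ∑ j with r j ≠ r j₀, (r j : ℂ) ^ s) := by
    rw [scalingDenom, ← Finset.sum_filter_add_sum_filter_not Finset.univ fun j => r j = r j₀]
    ring
  have htri := (norm_sub_le (1 : ℂ) _).trans (add_le_add_right (norm_add_le (scalingDenom r s)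
    (∑ j with r j ≠ r j₀, (r j : ℂ) ^ s)) _)
  rw [← hsplit, norm_one] at htri
  linarith

theorem tendsto_norm_scalingDenom_comap_re_atBot [Nonempty ι] (hr : ∀ j, 0 < r j)
    (hr1 : ∀ j, r j < 1) :
    Tendsto (fun s : ℂ => ‖scalingDenom r s‖) (comap Complex.re atBot) atTop := by
  obtain ⟨j₀, hj₀⟩ := Finite.exists_min r
  have hratios : Tendsto (fun σ : ℝ => ∑ j with r j ≠ r j₀, (r j / r j₀) ^ σ) atBot (𝓝 0) := by
    rw [← Finset.sum_const_zero (s := Finset.univ.filter fun j => r j ≠ r j₀)]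
    refine tendsto_finsetSum _ fun j hj => tendsto_rpow_atBot_of_base_gt_one _ ?_
    exact (one_lt_div (hr j₀)).2 ((hj₀ j).lt_of_ne' (Finset.mem_filter.1 hj).2)
  have hlower : Tendsto (fun σ : ℝ =>
      r j₀ ^ σ * (1 - ∑ j with r j ≠ r j₀, (r j / r j₀) ^ σ) - 1) atBot atTop :=
    tendsto_atTop_add_const_right _ _ <|
      (tendsto_rpow_atBot_of_base_lt_one _ (hr j₀) (hr1 j₀)).atTop_mul_pos one_pos
        (by simpa using hratios.const_sub 1)
  exact tendsto_atTop_mono (le_norm_scalingDenom_left hr j₀) (hlower.comp tendsto_comap)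

theorem exists_one_le_norm_scalingDenom_of_re_le [Nonempty ι] (hr : ∀ j, 0 < r j)
    (hr1 : ∀ j, r j < 1) : ∃ a : ℝ, ∀ s : ℂ, s.re ≤ a → 1 ≤ ‖scalingDenom r s‖ := by
  have hev := (tendsto_norm_scalingDenom_comap_re_atBot hr hr1).eventually_ge_atTop 1
  rw [eventually_comap, eventually_atBot] at hev
  obtain ⟨a, ha⟩ := hev
  exact ⟨a, fun s hs => ha s.re hs s rfl⟩

theorem finite_scalingDenom_zeros_strip (hr : ∀ j, 0 < r j) (hr1 : ∀ j, r j < 1)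
    (hD : ∑ j, r j ^ D = 1) (t : ℝ) : {s : ℂ | scalingDenom r s = 0 ∧ |s.im| ≤ t}.Finite := by
  have := nonempty_of_sum_rpow_eq_one hD
  obtain ⟨a, ha⟩ := exists_one_le_norm_scalingDenom_of_re_le hr hr1
  have hne : scalingDenom r ((D + 1 : ℝ) : ℂ) ≠ 0 :=
    scalingDenom_ne_zero_of_lt_re hr hr1 hD (by simp)
  refine (finite_zeros_of_isCompact (differentiable_scalingDenom hr) hne
    ((isCompact_Icc (a := a) (b := D)).reProdIm (isCompact_Icc (a := -t) (b := t)))).subset ?_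
  rintro s ⟨hs0, him⟩
  refine ⟨Complex.mem_reProdIm.2 ⟨⟨?_, ?_⟩, abs_le.1 him⟩, hs0⟩
  · by_contra! hre
    simpa [hs0] using (zero_lt_one.trans_le (ha s hre.le))
  · by_contra! hre
    exact scalingDenom_ne_zero_of_lt_re hr hr1 hD hre hs0

/-! ### Horizontal lines avoiding the complex dimensions -/

theorem scalingDenom_add_mul_I (hr : ∀ j, 0 < r j) (s : ℂ) (t : ℝ) :
    scalingDenom r (s + t * Complex.I) =
      weightedDenom (fun j => (r j : ℂ) ^ (t * Complex.I)) r s := by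
  simp only [scalingDenom, weightedDenom]
  congr! 2 with j
  rw [Complex.cpow_add _ _ (by exact_mod_cast (hr j).ne'), mul_comm]

theorem norm_weightedDenom_sub_le (hr : ∀ j, 0 < r j) (hr1 : ∀ j, r j < 1) (θ η : ι → ℂ) {a : ℝ}
    {s : ℂ} (hs : a ≤ s.re) :
    ‖weightedDenom θ r s - weightedDenom η r s‖ ≤ ∑ j, ‖θ j - η j‖ * r j ^ a := by
  have hsub : weightedDenom θ r s - weightedDenom η r s = -∑ j, (θ j - η j) * (r j : ℂ) ^ s := by
    simp only [weightedDenom, sub_mul, Finset.sum_sub_distrib]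
    ring
  rw [hsub, norm_neg]
  exact norm_sum_mul_cpow_le hr hr1 (θ - η) hs

theorem exists_subseq_tendsto_cpow_mul_I {ι : Type*} [Finite ι] {r : ι → ℝ}
    (hr : ∀ j, 0 < r j) :
    ∃ θ : ι → ℂ, (∀ j, ‖θ j‖ ≤ 1) ∧ ∃ φ : ℕ → ℕ, StrictMono φ ∧
      Tendsto (fun k j => (r j : ℂ) ^ (((φ k : ℝ) : ℂ) * Complex.I)) atTop (𝓝 θ) := by
  have := Fintype.ofFinite ι
  have hunit : ∀ n : ℕ, (fun j => (r j : ℂ) ^ (((n : ℝ) : ℂ) * Complex.I)) ∈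
      Metric.closedBall (0 : ι → ℂ) 1 := fun n => by
    rw [mem_closedBall_zero_iff, pi_norm_le_iff_of_nonneg zero_le_one]
    intro j
    simp [Complex.norm_cpow_eq_rpow_re_of_pos (hr j)]
  obtain ⟨θ, hθ, φ, hφ, hlim⟩ := (isCompact_closedBall (0 : ι → ℂ) 1).tendsto_subseq hunit
  exact ⟨θ, (pi_norm_le_iff_of_nonneg zero_le_one).1 (mem_closedBall_zero_iff.1 hθ), φ, hφ, hlim⟩

-- A subsequence of the vertical translates of the denominator by integers converges, uniformly on
-- `Re s ≥ a`, to a weighted denominator, and the latter has no zeros on some horizontal segment.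
theorem exists_heights_le_norm_scalingDenom_on_Icc (hr : ∀ j, 0 < r j) (hr1 : ∀ j, r j < 1)
    (hD : ∑ j, r j ^ D = 1) (a b : ℝ) :
    ∃ δ > 0, ∃ τ : ℕ → ℝ, StrictMono τ ∧ Tendsto τ atTop atTop ∧
      ∀ n, ∀ x ∈ Set.Icc a b, δ ≤ ‖scalingDenom r (x + τ n * Complex.I)‖ := by
  obtain ⟨θ, hθ, φ, hφ, hlim⟩ := exists_subseq_tendsto_cpow_mul_I hr
  have hne : weightedDenom θ r ((D + 1 : ℝ) : ℂ) ≠ 0 := norm_pos_iff.1 <|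
    (sub_pos.2 (sum_rpow_lt_one hr hr1 hD (lt_add_one D))).trans_le
      (le_norm_weightedDenom hr hr1 hθ (by simp))
  obtain ⟨y, -, δ, hδ, hle⟩ := exists_pos_le_norm_on_horizontal_segment
    (differentiable_weightedDenom hr θ) hne a b zero_lt_one
  have herr : Tendsto (fun k => ∑ j, ‖(r j : ℂ) ^ (((φ k : ℝ) : ℂ) * Complex.I) - θ j‖ * r j ^ a)
      atTop (𝓝 0) := by
    rw [← Finset.sum_const_zero (s := (Finset.univ : Finset ι))]
    refine tendsto_finsetSum _ fun j _ => ?_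
    simpa using (((tendsto_pi_nhds.1 hlim j).sub_const (θ j)).norm).mul_const (r j ^ a)
  obtain ⟨k₀, hk₀⟩ := eventually_atTop.1 (herr.eventually_le_const (half_pos hδ))
  refine ⟨δ / 2, half_pos hδ, fun n => y + φ (n + k₀), fun m n hmn => ?_, ?_, fun n x hx => ?_⟩
  · have := hφ (add_lt_add_left hmn k₀)
    simpa using this
  · exact tendsto_atTop_add_const_left _ _ <| tendsto_natCast_atTop_atTop.comp <|
      hφ.tendsto_atTop.comp (tendsto_add_atTop_nat k₀)
  · have hshift : (x + (y + φ (n + k₀) : ℝ) * Complex.I : ℂ) =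
        x + y * Complex.I + (φ (n + k₀) : ℝ) * Complex.I := by
      push_cast
      ring
    rw [hshift, scalingDenom_add_mul_I hr]
    have hclose := (norm_weightedDenom_sub_le hr hr1
      (fun j => (r j : ℂ) ^ (((φ (n + k₀) : ℝ) : ℂ) * Complex.I)) θ
      (s := x + y * Complex.I) (by simpa using hx.1)).trans (hk₀ _ (Nat.le_add_left _ _))
    rw [norm_sub_rev] at hclose
    linarith [hle x hx, norm_sub_norm_le (weightedDenom θ r (x + y * Complex.I)) _ |>.trans hclose]

theorem exists_heights_le_norm_scalingDenom (hr : ∀ j, 0 < r j) (hr1 : ∀ j, r j < 1)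
    (hD : ∑ j, r j ^ D = 1) :
    ∃ δ > 0, ∃ τ : ℕ → ℝ, StrictMono τ ∧ Tendsto τ atTop atTop ∧
      ∀ n, ∀ s : ℂ, |s.im| = τ n → δ ≤ ‖scalingDenom r s‖ := by
  have := nonempty_of_sum_rpow_eq_one hD
  obtain ⟨a, ha⟩ := exists_one_le_norm_scalingDenom_of_re_le hr hr1
  obtain ⟨δ, hδ, τ, hτ, hτlim, hle⟩ :=
    exists_heights_le_norm_scalingDenom_on_Icc hr hr1 hD a (D + 1)
  have hsum := sub_pos.2 (sum_rpow_lt_one hr hr1 hD (lt_add_one D))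
  refine ⟨min δ (min 1 (1 - ∑ j, r j ^ (D + 1))), by positivity, τ, hτ, hτlim, fun n s hs => ?_⟩
  have hupper : ∀ z : ℂ, z.im = τ n → min δ (min 1 (1 - ∑ j, r j ^ (D + 1))) ≤
      ‖scalingDenom r z‖ := by
    intro z hz
    rcases le_total z.re a with hza | hza
    · exact (min_le_right _ _).trans ((min_le_left _ _).trans (ha z hza))
    rcases le_total (D + 1) z.re with hzD | hzD
    · exact (min_le_right _ _).trans
        ((min_le_right _ _).trans (le_norm_scalingDenom hr hr1 hzD))
    · have := hle n z.re ⟨hza, hzD⟩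
      rw [← hz, Complex.re_add_im] at this
      exact (min_le_left _ _).trans this
  rcases abs_choice s.im with him | him
  · exact hupper s (him ▸ hs)
  · rw [← norm_scalingDenom_conj hr]
    exact hupper _ (by rw [Complex.conj_im, ← him, hs])

end ScalingDenom

/-! ### The complex dimensions -/

section ComplexDimensions

variable {J : ℕ} {r : Fin J → ℝ} {D : ℝ}

theorem mem_complexDimensions_iff (hr : ∀ j, 0 < r j) (hr1 : ∀ j, r j < 1)
    (hD : ∑ j, r j ^ D = 1) {ω : ℂ} : ω ∈ complexDimensions r ↔ scalingDenom r ω = 0 :=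
  meromorphicOrderAt_inv_neg_iff (differentiable_scalingDenom hr)
    (scalingDenom_ne_zero_of_lt_re hr hr1 hD (s := (D + 1 : ℝ)) (by simp)) ω

theorem finite_tilingDimensions_strip (hr : ∀ j, 0 < r j) (hr1 : ∀ j, r j < 1)
    (hD : ∑ j, r j ^ D = 1) (d : ℕ) (t : ℝ) : {ω ∈ tilingDimensions d r | |ω.im| ≤ t}.Finite := by
  refine ((finite_scalingDenom_zeros_strip hr hr1 hD t).union
    ((Finset.range d).finite_toSet.image fun i : ℕ => (i : ℂ))).subset ?_
  rintro ω ⟨hω | ⟨i, hi, rfl⟩, him⟩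
  · exact Or.inl ⟨(mem_complexDimensions_iff hr hr1 hD).1 hω, him⟩
  · exact Or.inr ⟨i, by simpa using hi, rfl⟩

end ComplexDimensions

/-! ### The geometric zeta function -/

section GeometricZeta

variable {d J : ℕ} {r : Fin J → ℝ} {κ : ℕ → ℝ} {h g ε : ℝ} {lam : ℝ → ℝ}

theorem meromorphicAt_tubeTransform (hh : 0 < h) (hhg : h ≤ g)
    (hlam : IntegrableOn lam (Set.Ioc h g)) (z : ℂ) :
    MeromorphicAt (tubeTransform d κ h g lam) z := by
  have hpow : ∀ x : ℝ, 0 < x → ∀ i : ℕ, MeromorphicAt (fun s : ℂ => (x : ℂ) ^ (s - i)) z := by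
    intro x hx i
    have hdiff : Differentiable ℂ fun s : ℂ => (x : ℂ) ^ (s - i) :=
      (differentiable_id.sub_const _).const_cpow (Or.inl (by exact_mod_cast hx.ne'))
    exact (hdiff.analyticAt z).meromorphicAt
  have hterm : ∀ x : ℝ, 0 < x → ∀ i : ℕ,
      MeromorphicAt (fun s : ℂ => (x : ℂ) ^ (s - i) / (s - i) * (κ i : ℂ)) z := fun x hx i =>
    ((hpow x hx i).div ((MeromorphicAt.id z).sub (.const _ z))).mul (.const _ z)
  exact ((MeromorphicAt.fun_sum fun i _ => hterm h hh i).add (hterm g (hh.trans_le hhg) d)).add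
    ((differentiable_Lam hh hhg hlam).analyticAt z).meromorphicAt

theorem differentiableAt_tubeTransform (hh : 0 < h) (hhg : h ≤ g)
    (hlam : IntegrableOn lam (Set.Ioc h g)) {z : ℂ} (hz : ∀ i ≤ d, z ≠ (i : ℕ)) :
    DifferentiableAt ℂ (tubeTransform d κ h g lam) z := by
  have hterm : ∀ x : ℝ, 0 < x → ∀ i ≤ d,
      DifferentiableAt ℂ (fun s : ℂ => (x : ℂ) ^ (s - i) / (s - i) * (κ i : ℂ)) z := by
    intro x hx i hi
    have hsub : DifferentiableAt ℂ (fun s : ℂ => s - (i : ℂ)) z := differentiableAt_id.sub_const _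
    exact ((hsub.const_cpow (Or.inl (by exact_mod_cast hx.ne'))).div hsub
      (sub_ne_zero.2 (hz i hi))).mul_const _
  exact ((DifferentiableAt.fun_sum fun i hi => hterm h hh i (Finset.mem_range.1 hi).le).add
    (hterm g (hh.trans_le hhg) d le_rfl)).add (differentiable_Lam hh hhg hlam z)

theorem geometricZeta_eq (d : ℕ) (r : Fin J → ℝ) (κ : ℕ → ℝ) (h g : ℝ) (lam : ℝ → ℝ)
    (ε : ℝ) (s : ℂ) : geometricZeta d r κ h g lam ε s =
      (scalingDenom r s)⁻¹ * (ε : ℂ) ^ ((d : ℂ) - s) * tubeTransform d κ h g lam s := rfl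

theorem differentiable_cpow_natCast_sub (hε : 0 < ε) (d : ℕ) :
    Differentiable ℂ fun s : ℂ => (ε : ℂ) ^ ((d : ℂ) - s) :=
  (differentiable_id.const_sub _).const_cpow (Or.inl (by exact_mod_cast hε.ne'))

theorem meromorphicAt_geometricZeta (hr : ∀ j, 0 < r j) (hh : 0 < h) (hhg : h ≤ g)
    (hlam : IntegrableOn lam (Set.Ioc h g)) (hε : 0 < ε) (z : ℂ) :
    MeromorphicAt (geometricZeta d r κ h g lam ε) z :=
  (((differentiable_scalingDenom hr).analyticAt z).meromorphicAt.inv.mul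
    ((differentiable_cpow_natCast_sub hε d).analyticAt z).meromorphicAt).mul
      (meromorphicAt_tubeTransform hh hhg hlam z)

theorem differentiableAt_geometricZeta (hr : ∀ j, 0 < r j) (hh : 0 < h) (hhg : h ≤ g)
    (hlam : IntegrableOn lam (Set.Ioc h g)) (hε : 0 < ε) {z : ℂ} (hz : ∀ i ≤ d, z ≠ (i : ℕ))
    (hz0 : scalingDenom r z ≠ 0) : DifferentiableAt ℂ (geometricZeta d r κ h g lam ε) z :=
  ((((differentiable_scalingDenom hr) z).inv hz0).mul (differentiable_cpow_natCast_sub hε d z)).mul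
    (differentiableAt_tubeTransform hh hhg hlam hz)

theorem IsTubeFunction.exists_norm_geometricZeta_le {V : ℝ → ℝ} (H : IsTubeFunction V d κ h g lam)
    (r : Fin J → ℝ) (hε : 0 < ε) {δ : ℝ} (hδ : 0 < δ) :
    ∃ K : ℝ, 0 ≤ K ∧ ∀ s : ℂ, s.re ≤ d → (∀ i ≤ d, 1 ≤ ‖s - (i : ℕ)‖) →
      δ ≤ ‖scalingDenom r s‖ →
      ‖geometricZeta d r κ h g lam ε s‖ ≤ K * (h / ε) ^ s.re / ‖s - d‖ := by
  obtain ⟨K, hK0, hK⟩ := H.exists_norm_tubeTransform_le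
  refine ⟨δ⁻¹ * ε ^ (d : ℝ) * K, by positivity, fun s hs hdist hδs => ?_⟩
  have hε_pow : ‖(ε : ℂ) ^ ((d : ℂ) - s)‖ = ε ^ (d : ℝ) / ε ^ s.re := by
    rw [Complex.norm_cpow_eq_rpow_re_of_pos hε, ← Real.rpow_sub hε, Complex.sub_re,
      Complex.natCast_re]
  calc ‖geometricZeta d r κ h g lam ε s‖
      = ‖scalingDenom r s‖⁻¹ * (ε ^ (d : ℝ) / ε ^ s.re) * ‖tubeTransform d κ h g lam s‖ := by
        rw [geometricZeta_eq, norm_mul, norm_mul, norm_inv, hε_pow]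
    _ ≤ δ⁻¹ * (ε ^ (d : ℝ) / ε ^ s.re) * (K * h ^ s.re / ‖s - d‖) := by
        gcongr
        exact hK s hs hdist
    _ = δ⁻¹ * ε ^ (d : ℝ) * K * (h / ε) ^ s.re / ‖s - d‖ := by
        rw [Real.div_rpow H.h_pos.le hε.le]
        ring

end GeometricZeta

/-! ### Summing the tubes of all generations under the integral -/

section FunctionalEquation

variable {ι : Type*} [Fintype ι] {r : ι → ℝ} {d : ℕ} {c x : ℝ} {T : ℝ → ℂ}

theorem norm_sum_cpow_vertical_le (hr : ∀ j, 0 < r j) (c t : ℝ) :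
    ‖∑ j, (r j : ℂ) ^ (c + t * Complex.I)‖ ≤ ∑ j, r j ^ c :=
  norm_sum_le_of_le _ fun j _ => by simp [Complex.norm_cpow_eq_rpow_re_of_pos (hr j)]

theorem integrable_cpow_mul_vertical (hT : Integrable T) (hx : 0 < x) (d : ℕ) (c : ℝ) :
    Integrable fun t : ℝ => (x : ℂ) ^ (d - (c + t * Complex.I)) * T t := by
  have hcont : Continuous fun t : ℝ => (x : ℂ) ^ (d - (c + t * Complex.I)) :=
    (differentiable_cpow_natCast_sub hx d).continuous.comp (by fun_prop)
  exact hT.bdd_mul (c := x ^ (d - c)) hcont.aestronglyMeasurable <|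
    Eventually.of_forall fun t => by simp [Complex.norm_cpow_eq_rpow_re_of_pos hx]

theorem integrable_sum_cpow_pow_mul_vertical (hr : ∀ j, 0 < r j) (hT : Integrable T) (c : ℝ)
    (k : ℕ) : Integrable fun t : ℝ => (∑ j, (r j : ℂ) ^ (c + t * Complex.I)) ^ k * T t := by
  have hcont : Continuous fun t : ℝ => ∑ j, (r j : ℂ) ^ (c + t * Complex.I) :=
    continuous_finsetSum _ fun j _ => Continuous.const_cpow (by fun_prop)
      (Or.inl (by exact_mod_cast (hr j).ne'))
  refine hT.bdd_mul (c := (∑ j, r j ^ c) ^ k) (hcont.pow k).aestronglyMeasurable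
    (Eventually.of_forall fun t => ?_)
  rw [norm_pow]
  exact pow_le_pow_left₀ (norm_nonneg _) (norm_sum_cpow_vertical_le hr c t) k

theorem pow_mul_div_cpow_sub {ρ : ℝ} (hρ : 0 < ρ) (hx : 0 < x) (d : ℕ) (s : ℂ) :
    (ρ : ℂ) ^ d * ((x / ρ : ℝ) : ℂ) ^ (d - s) = (ρ : ℂ) ^ s * (x : ℂ) ^ (d - s) := by
  have hρ0 : (ρ : ℂ) ≠ 0 := by exact_mod_cast hρ.ne'
  have hx_eq : (x : ℂ) = (ρ : ℂ) * ((x / ρ : ℝ) : ℂ) := by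
    rw [← Complex.ofReal_mul, mul_div_cancel₀ _ hρ.ne']
  rw [hx_eq, Complex.mul_cpow_ofReal_nonneg hρ.le (div_pos hx hρ).le, ← mul_assoc,
    ← Complex.cpow_add _ _ hρ0, add_sub_cancel, Complex.cpow_natCast]

-- The functional equation multiplies the Mellin transform by `∑ r_j^s`.
theorem iterate_eq_integral_vertical (hr : ∀ j, 0 < r j) (hT : Integrable T) {W : ℕ → ℝ → ℂ}
    (hW_zero : ∀ x, 0 < x → W 0 x = (1 / (2 * Real.pi) : ℝ) *
      ∫ t : ℝ, (x : ℂ) ^ (d - (c + t * Complex.I)) * T t)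
    (hW_succ : ∀ k x, W (k + 1) x = ∑ j, (r j : ℂ) ^ d * W k (x / r j)) (k : ℕ) (hx : 0 < x) :
    W k x = (1 / (2 * Real.pi) : ℝ) * ∫ t : ℝ, (∑ j, (r j : ℂ) ^ (c + t * Complex.I)) ^ k *
      ((x : ℂ) ^ (d - (c + t * Complex.I)) * T t) := by
  induction k generalizing x with
  | zero => simpa using hW_zero x hx
  | succ k ih =>
    have hint : ∀ j ∈ Finset.univ, Integrable fun t : ℝ =>
        (r j : ℂ) ^ d * ((∑ j, (r j : ℂ) ^ (c + t * Complex.I)) ^ k *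
          (((x / r j : ℝ) : ℂ) ^ (d - (c + t * Complex.I)) * T t)) := fun j _ =>
      (integrable_sum_cpow_pow_mul_vertical hr
        (integrable_cpow_mul_vertical hT (div_pos hx (hr j)) d c) c k).const_mul _
    simp only [hW_succ, ih (div_pos hx (hr _)), mul_left_comm ((r _ : ℂ) ^ d), ← Finset.mul_sum]
    congr 1
    simp_rw [← integral_const_mul]
    rw [← integral_finsetSum _ hint]
    congr 1
    ext t
    rw [pow_succ, mul_assoc, Finset.sum_mul, Finset.mul_sum]
    refine Finset.sum_congr rfl fun j _ => ?_
    linear_combination ((∑ j, (r j : ℂ) ^ (c + t * Complex.I)) ^ k * T t) *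
      pow_mul_div_cpow_sub (hr j) hx d (c + t * Complex.I)

theorem integrable_inv_scalingDenom_mul_vertical (hr : ∀ j, 0 < r j) (hr1 : ∀ j, r j < 1)
    (hc : ∑ j, r j ^ c < 1) (hT : Integrable T) :
    Integrable fun t : ℝ => (scalingDenom r (c + t * Complex.I))⁻¹ * T t := by
  have hle : ∀ t : ℝ, 1 - ∑ j, r j ^ c ≤ ‖scalingDenom r (c + t * Complex.I)‖ := fun t =>
    le_norm_scalingDenom hr hr1 (by simp)
  have hcont : Continuous fun t : ℝ => (scalingDenom r (c + t * Complex.I))⁻¹ :=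
    ((differentiable_scalingDenom hr).continuous.comp (by fun_prop)).inv₀ fun t =>
      norm_pos_iff.1 ((sub_pos.2 hc).trans_le (hle t))
  refine hT.bdd_mul (c := (1 - ∑ j, r j ^ c)⁻¹) hcont.aestronglyMeasurable
    (Eventually.of_forall fun t => ?_)
  rw [norm_inv]
  exact inv_anti₀ (sub_pos.2 hc) (hle t)

theorem hasSum_integral_sum_cpow_pow_mul_vertical (hr : ∀ j, 0 < r j) (hc : ∑ j, r j ^ c < 1)
    (hT : Integrable T) :
    HasSum (fun k : ℕ => ∫ t : ℝ, (∑ j, (r j : ℂ) ^ (c + t * Complex.I)) ^ k * T t)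
      (∫ t : ℝ, (scalingDenom r (c + t * Complex.I))⁻¹ * T t) := by
  have hgeom : ∀ t : ℝ, ∑' k : ℕ, (∑ j, (r j : ℂ) ^ (c + t * Complex.I)) ^ k * T t =
      (scalingDenom r (c + t * Complex.I))⁻¹ * T t := fun t =>
    ((hasSum_geometric_of_norm_lt_one ((norm_sum_cpow_vertical_le hr c t).trans_lt hc)).mul_right
      (T t)).tsum_eq
  have hterm := integrable_sum_cpow_pow_mul_vertical hr hT c
  simp only [← hgeom]
  refine hasSum_integral_of_summable_integral_norm hterm <|
    Summable.of_nonneg_of_le (fun k => integral_nonneg fun t => norm_nonneg _) (fun k => ?_)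
      ((summable_geometric_of_lt_one
        (Finset.sum_nonneg fun j _ => Real.rpow_nonneg (hr j).le c) hc).mul_right (∫ t, ‖T t‖))
  rw [← integral_const_mul]
  refine integral_mono (hterm k).norm (hT.norm.const_mul _) fun t => ?_
  simp only [norm_mul, norm_pow]
  gcongr
  exact norm_sum_cpow_vertical_le hr c t

theorem hasSum_iterate_integral_vertical (hr : ∀ j, 0 < r j) (hc : ∑ j, r j ^ c < 1)
    (hT : Integrable T) {W : ℕ → ℝ → ℂ}
    (hW_zero : ∀ x, 0 < x → W 0 x = (1 / (2 * Real.pi) : ℝ) *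
      ∫ t : ℝ, (x : ℂ) ^ (d - (c + t * Complex.I)) * T t)
    (hW_succ : ∀ k x, W (k + 1) x = ∑ j, (r j : ℂ) ^ d * W k (x / r j)) (hx : 0 < x) :
    HasSum (fun k => W k x) ((1 / (2 * Real.pi) : ℝ) * ∫ t : ℝ,
      (scalingDenom r (c + t * Complex.I))⁻¹ * ((x : ℂ) ^ (d - (c + t * Complex.I)) * T t)) := by
  simp only [iterate_eq_integral_vertical hr hT hW_zero hW_succ _ hx]
  exact (hasSum_integral_sum_cpow_pow_mul_vertical hr hc
    (integrable_cpow_mul_vertical hT hx d c)).mul_left _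

end FunctionalEquation

/-! ### Shifting the contour to the left -/

section LeftShift

theorem intervalIntegral_rpow_const_le {b : ℝ} (hb : 1 < b) (x y : ℝ) :
    ∫ t in x..y, b ^ t ≤ b ^ y / Real.log b := by
  have hb0 : 0 < b := one_pos.trans hb
  have hlog : 0 < Real.log b := Real.log_pos hb
  have hderiv : ∀ t ∈ Set.uIcc x y, HasDerivAt (fun t : ℝ => b ^ t / Real.log b) (b ^ t) t := by
    intro t _
    have hpow := (Real.hasStrictDerivAt_const_rpow hb0 t).hasDerivAt.div_const (Real.log b)
    rwa [mul_div_cancel_right₀ _ hlog.ne'] at hpow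
  rw [intervalIntegral.integral_eq_sub_of_hasDerivAt hderiv
    ((Real.continuous_const_rpow hb0.ne').intervalIntegrable x y)]
  exact sub_le_self _ (by positivity)

theorem norm_intervalIntegral_le_of_norm_le_rpow {φ : ℝ → ℂ} {b c x M : ℝ} (hb : 1 < b)
    (hM : 0 ≤ M) (hxc : x ≤ c) (hφ : ∀ t ≤ c, ‖φ t‖ ≤ M * b ^ t) :
    ‖∫ t in x..c, φ t‖ ≤ M * (b ^ c / Real.log b) :=
  calc ‖∫ t in x..c, φ t‖ ≤ ∫ t in x..c, M * b ^ t :=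
        intervalIntegral.norm_integral_le_of_norm_le hxc
          (Eventually.of_forall fun t ht => hφ t ht.2)
          (((Real.continuous_const_rpow (one_pos.trans hb).ne').const_mul M).intervalIntegrable x c)
    _ ≤ M * (b ^ c / Real.log b) := by
        rw [intervalIntegral.integral_const_mul]
        exact mul_le_mul_of_nonneg_left (intervalIntegral_rpow_const_le hb x c) hM

theorem norm_sum_residue_sub_integral_le_of_lt {f : ℂ → ℂ} {x c τ B L : ℝ} (hxc : x ≤ c)
    (hτ : 0 ≤ τ) (S : Finset ℂ) (hS : ∀ ω ∈ S, x < ω.re ∧ ω.re < c ∧ |ω.im| < τ)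
    (hmer : ∀ ω ∈ S, MeromorphicAt f ω)
    (hf : ∀ z : ℂ, z.re ≤ c → |z.im| ≤ τ → z ∉ S → DifferentiableAt ℂ f z)
    (hhor : ∀ y : ℝ, |y| = τ → ‖∫ t in x..c, f (t + y * Complex.I)‖ ≤ B)
    (hleft : ‖∫ y in (-τ)..τ, f (x + y * Complex.I)‖ ≤ L) :
    ‖∑ ω ∈ S, residue f ω - (1 / (2 * Real.pi) : ℝ) * ∫ t in (-τ)..τ, f (c + t * Complex.I)‖ ≤
      1 / (2 * Real.pi) * (2 * B + L) := by
  have hrect := rectIntegral_eq_sum_residue hxc (neg_le_self hτ) S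
    (fun ω hω => ⟨⟨(hS ω hω).1, (hS ω hω).2.1⟩, abs_lt.1 (hS ω hω).2.2⟩) hmer
    fun z hz => hf z hz.1.2 (abs_le.2 hz.2)
  rw [rectIntegral] at hrect
  have hbottom := hhor (-τ) (by rw [abs_neg, abs_of_nonneg hτ])
  have htop := hhor τ (abs_of_nonneg hτ)
  set I₁ := ∫ t in x..c, f (t + (-τ : ℝ) * Complex.I)
  set I₂ := ∫ t in x..c, f (t + τ * Complex.I)
  set I₃ := ∫ y in (-τ)..τ, f (x + y * Complex.I)
  set I₄ := ∫ t in (-τ)..τ, f (c + t * Complex.I)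
  have hrest : ∑ ω ∈ S, residue f ω - (1 / (2 * Real.pi) : ℝ) * I₄ =
      (2 * Real.pi * Complex.I)⁻¹ * (I₁ - I₂ - Complex.I * I₃) := by
    have hpi : (Real.pi : ℂ) ≠ 0 := by exact_mod_cast Real.pi_ne_zero
    rw [eq_inv_mul_iff_mul_eq₀ Complex.two_pi_I_ne_zero, mul_sub, ← hrect]
    push_cast
    field_simp
    ring
  have hpi_norm : ‖(2 * Real.pi * Complex.I : ℂ)⁻¹‖ = 1 / (2 * Real.pi) := by
    simp [abs_of_pos Real.pi_pos]
  rw [hrest, norm_mul, hpi_norm]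
  gcongr
  calc ‖I₁ - I₂ - Complex.I * I₃‖ ≤ ‖I₁ - I₂‖ + ‖Complex.I * I₃‖ := norm_sub_le _ _
    _ ≤ ‖I₁‖ + ‖I₂‖ + ‖I₃‖ := by
        rw [norm_mul, Complex.norm_I, one_mul]
        gcongr
        exact norm_sub_le _ _
    _ ≤ 2 * B + L := by linarith

theorem norm_sum_residue_sub_integral_le {f : ℂ → ℂ} {a b c τ K M : ℝ} (hb : 1 < b) (hτ : 0 ≤ τ)
    (S : Finset ℂ) (hS : ∀ ω ∈ S, ω.re < c ∧ |ω.im| < τ) (hmer : ∀ ω ∈ S, MeromorphicAt f ω)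
    (hf : ∀ z : ℂ, z.re ≤ c → |z.im| ≤ τ → z ∉ S → DifferentiableAt ℂ f z)
    (hhor : ∀ z : ℂ, z.re ≤ c → |z.im| = τ → ‖f z‖ ≤ M * b ^ z.re)
    (hleft : ∀ z : ℂ, z.re ≤ a → |z.im| ≤ τ → ‖f z‖ ≤ K * b ^ z.re) :
    ‖∑ ω ∈ S, residue f ω - (1 / (2 * Real.pi) : ℝ) * ∫ t in (-τ)..τ, f (c + t * Complex.I)‖ ≤
      M * b ^ c / (Real.pi * Real.log b) := by
  have hM : 0 ≤ M := by
    have hnorm := (norm_nonneg _).trans (hhor (c + τ * Complex.I) (by simp) (by simp [hτ]))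
    exact nonneg_of_mul_nonneg_left hnorm (by positivity)
  have hbound : ∀ᶠ x : ℝ in atBot, ‖∑ ω ∈ S, residue f ω -
      (1 / (2 * Real.pi) : ℝ) * ∫ t in (-τ)..τ, f (c + t * Complex.I)‖ ≤
        1 / (2 * Real.pi) * (2 * (M * (b ^ c / Real.log b)) + K * b ^ x * |τ - -τ|) := by
    filter_upwards [eventually_le_atBot a, eventually_le_atBot c,
      (Finset.eventually_all S).2 fun ω _ => eventually_lt_atBot ω.re] with x hxa hxc hxS
    refine norm_sum_residue_sub_integral_le_of_lt hxc hτ S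
      (fun ω hω => ⟨hxS ω hω, hS ω hω⟩) hmer hf (fun y hy => ?_) ?_
    · exact norm_intervalIntegral_le_of_norm_le_rpow hb hM hxc fun t ht => by
        simpa using hhor (t + y * Complex.I) (by simpa using ht) (by simpa using hy)
    · refine intervalIntegral.norm_integral_le_of_norm_le_const fun y hy => ?_
      rw [Set.uIoc_of_le (neg_le_self hτ)] at hy
      simpa using hleft (x + y * Complex.I) (by simpa using hxa)
        (by simpa using abs_le.2 ⟨hy.1.le, hy.2⟩)
  have hlim : Tendsto (fun x : ℝ => 1 / (2 * Real.pi) *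
      (2 * (M * (b ^ c / Real.log b)) + K * b ^ x * |τ - -τ|)) atBot
      (𝓝 (1 / (2 * Real.pi) * (2 * (M * (b ^ c / Real.log b)) + K * 0 * |τ - -τ|))) :=
    ((((tendsto_rpow_atBot_of_base_gt_one b hb).const_mul K).mul_const _).const_add _).const_mul _
  refine (ge_of_tendsto hlim hbound).trans_eq ?_
  ring

variable {d J : ℕ} {r : Fin J → ℝ} {κ : ℕ → ℝ} {h g ε D c τ δ : ℝ} {lam V : ℝ → ℝ}

theorem re_lt_and_abs_im_lt_of_mem_tilingDimensions (hr : ∀ j, 0 < r j) (hr1 : ∀ j, r j < 1)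
    (hD : ∑ j, r j ^ D = 1) (hDc : D < c) (hdc : (d : ℝ) - 1 < c) (hτ : 0 < τ)
    (hline : ∀ s : ℂ, |s.im| = τ → scalingDenom r s ≠ 0) {ω : ℂ} (hω : ω ∈ tilingDimensions d r)
    (him : |ω.im| ≤ τ) : ω.re < c ∧ |ω.im| < τ := by
  rcases hω with hω | ⟨i, hi, rfl⟩
  · rw [mem_complexDimensions_iff hr hr1 hD] at hω
    refine ⟨lt_of_le_of_lt ?_ hDc, him.lt_of_ne fun heq => hline ω heq hω⟩
    exact not_lt.1 fun hlt => scalingDenom_ne_zero_of_lt_re hr hr1 hD hlt hω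
  · have hi' : (i : ℝ) + 1 ≤ d := by exact_mod_cast hi
    simp only [Complex.natCast_re, Complex.natCast_im, abs_zero]
    exact ⟨by linarith, hτ⟩

theorem differentiableAt_geometricZeta_of_notMem_tilingDimensions (hr : ∀ j, 0 < r j)
    (hr1 : ∀ j, r j < 1) (hD : ∑ j, r j ^ D = 1) (hh : 0 < h) (hhg : h ≤ g)
    (hlam : IntegrableOn lam (Set.Ioc h g)) (hε : 0 < ε) {z : ℂ} (hz : z ∉ tilingDimensions d r)
    (hzd : z ≠ d) : DifferentiableAt ℂ (geometricZeta d r κ h g lam ε) z := by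
  refine differentiableAt_geometricZeta hr hh hhg hlam hε (fun i hi hzi => ?_) fun hz0 =>
    hz (Or.inl ((mem_complexDimensions_iff hr hr1 hD).2 hz0))
  rcases hi.lt_or_eq with hi | rfl
  · exact hz (Or.inr ⟨i, hi, hzi⟩)
  · exact hzd hzi

namespace IsTubeFunction

theorem exists_norm_geometricZeta_le_of_one_le_abs_im (H : IsTubeFunction V d κ h g lam)
    (r : Fin J → ℝ) (hε : 0 < ε) (hδ : 0 < δ) :
    ∃ K : ℝ, ∀ s : ℂ, s.re ≤ d → 1 ≤ |s.im| → δ ≤ ‖scalingDenom r s‖ →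
      ‖geometricZeta d r κ h g lam ε s‖ ≤ K / |s.im| * (h / ε) ^ s.re := by
  obtain ⟨K, hK0, hK⟩ := H.exists_norm_geometricZeta_le r hε hδ
  refine ⟨K, fun s hs him hδs => ?_⟩
  have hdist (i : ℕ) : |s.im| ≤ ‖s - i‖ := by simpa using Complex.abs_im_le_norm (s - i)
  have hb : 0 < h / ε := div_pos H.h_pos hε
  calc ‖geometricZeta d r κ h g lam ε s‖ ≤ K * (h / ε) ^ s.re / ‖s - d‖ :=
        hK s hs (fun i _ => him.trans (hdist i)) hδs
    _ ≤ K * (h / ε) ^ s.re / |s.im| := by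
        gcongr
        exact hdist d
    _ = K / |s.im| * (h / ε) ^ s.re := by ring

theorem exists_norm_geometricZeta_le_of_re_le [Nonempty (Fin J)] (H : IsTubeFunction V d κ h g lam)
    (hr : ∀ j, 0 < r j) (hr1 : ∀ j, r j < 1) (hε : 0 < ε) :
    ∃ a K : ℝ, ∀ s : ℂ, s.re ≤ a → ‖geometricZeta d r κ h g lam ε s‖ ≤ K * (h / ε) ^ s.re := by
  obtain ⟨K, hK0, hK⟩ := H.exists_norm_geometricZeta_le r hε one_pos
  obtain ⟨a, ha⟩ := exists_one_le_norm_scalingDenom_of_re_le hr hr1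
  refine ⟨min a (-1), K, fun s hs => ?_⟩
  have hre : s.re ≤ -1 := hs.trans (min_le_right _ _)
  have hdist (i : ℕ) : 1 ≤ ‖s - i‖ := by
    calc (1 : ℝ) ≤ -(s - i).re := by
          rw [Complex.sub_re, Complex.natCast_re]
          linarith [i.cast_nonneg (α := ℝ)]
      _ ≤ ‖s - i‖ := (neg_le_abs _).trans (Complex.abs_re_le_norm _)
  have hb : 0 < h / ε := div_pos H.h_pos hε
  have hsd : s.re ≤ d := by linarith [d.cast_nonneg (α := ℝ)]
  exact (hK s hsd (fun i _ => hdist i) (ha s (hs.trans (min_le_left _ _)))).trans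
    (div_le_self (by positivity) (hdist d))

theorem exists_norm_sum_residue_sub_integral_le (H : IsTubeFunction V d κ h g lam)
    (hr : ∀ j, 0 < r j) (hr1 : ∀ j, r j < 1) (hD : ∑ j, r j ^ D = 1) (hDc : D < c)
    (hdc : (d : ℝ) - 1 < c) (hcd : c < d) (hε : 0 < ε) (hεh : ε < h) (hδ : 0 < δ) :
    ∃ K : ℝ, ∀ τ : ℝ, 1 ≤ τ → (∀ s : ℂ, |s.im| = τ → δ ≤ ‖scalingDenom r s‖) →
      ‖∑ᶠ ω ∈ {ω ∈ tilingDimensions d r | |ω.im| ≤ τ}, residue (geometricZeta d r κ h g lam ε) ω -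
        (1 / (2 * Real.pi) : ℝ) *
          ∫ t in (-τ)..τ, geometricZeta d r κ h g lam ε (c + t * Complex.I)‖ ≤ K / τ := by
  have := nonempty_of_sum_rpow_eq_one hD
  have hlam : IntegrableOn lam (Set.Ioc h g) :=
    H.piecewise.1.integrableOn_Icc.mono_set Set.Ioc_subset_Icc_self
  obtain ⟨K, hK⟩ := H.exists_norm_geometricZeta_le_of_one_le_abs_im r hε hδ
  obtain ⟨a, L, hL⟩ := H.exists_norm_geometricZeta_le_of_re_le hr hr1 hε
  refine ⟨K * (h / ε) ^ c / (Real.pi * Real.log (h / ε)), fun τ hτ hτδ => ?_⟩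
  have hτ0 : 0 < τ := one_pos.trans_le hτ
  have hfin := finite_tilingDimensions_strip hr hr1 hD d τ
  have hline : ∀ s : ℂ, |s.im| = τ → scalingDenom r s ≠ 0 := fun s hs =>
    norm_pos_iff.1 (hδ.trans_le (hτδ s hs))
  rw [finsum_mem_eq_finite_toFinset_sum _ hfin]
  refine (norm_sum_residue_sub_integral_le (a := a) (b := h / ε) (K := L) (M := K / τ)
    ((one_lt_div hε).2 hεh) hτ0.le hfin.toFinset (fun ω hω => ?_)
    (fun ω _ => meromorphicAt_geometricZeta hr H.h_pos H.h_lt_g.le hlam hε ω)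
    (fun z hzc hzτ hz => ?_) (fun z hzc hzτ => ?_) fun z hza _ => hL z hza).trans_eq (by ring)
  · obtain ⟨hω, him⟩ := hfin.mem_toFinset.1 hω
    exact re_lt_and_abs_im_lt_of_mem_tilingDimensions hr hr1 hD hDc hdc hτ0 hline hω him
  · refine differentiableAt_geometricZeta_of_notMem_tilingDimensions hr hr1 hD H.h_pos H.h_lt_g.le
      hlam hε (fun hmem => hz (hfin.mem_toFinset.2 ⟨hmem, hzτ⟩)) ?_
    rintro rfl
    exact (hzc.trans_lt hcd).ne (Complex.natCast_re d)
  · exact hzτ ▸ hK z (hzc.trans hcd.le) (hzτ ▸ hτ) (hτδ z hzτ)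

end IsTubeFunction

end LeftShift

/-! ### The tube formula -/

theorem nonneg_of_sum_rpow_eq_one {ι : Type*} [Fintype ι] {r : ι → ℝ} {D : ℝ} (hr : ∀ j, 0 < r j)
    (hr1 : ∀ j, r j < 1) (hD : ∑ j, r j ^ D = 1) : 0 ≤ D := by
  by_contra! hneg
  have := nonempty_of_sum_rpow_eq_one hD
  have hcard : (Fintype.card ι : ℝ) < 1 := by simpa using sum_rpow_lt_one hr hr1 hD hneg
  exact Fintype.card_ne_zero (Nat.lt_one_iff.1 (by exact_mod_cast hcard))

theorem isTubeFunction_innerTubeVolume {d : ℕ} (hd : 0 < d) {G : Set (Euc d)} (hG : IsOpen G)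
    (hGb : Bornology.IsBounded G) {h g : ℝ} {κ : ℕ → ℝ} {lam : ℝ → ℝ} (hg : g = inradius G)
    (hh : 0 < h) (hhg : h < g)
    (hpoly : ∀ ε, 0 < ε → ε < h →
      innerTubeVolume G ε = ∑ i ∈ Finset.range d, κ i * ε ^ (d - i))
    (hlam : ∀ ε, h ≤ ε → ε ≤ g → innerTubeVolume G ε = lam ε) (hlamC1 : PiecewiseC1On lam h g)
    (hκd : κ d = -(volume : Measure (Euc d)).real G) :
    IsTubeFunction (innerTubeVolume G) d κ h g lam where
  h_pos := hh
  h_lt_g := hhg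
  continuousAt x hx := by
    have : Nonempty (Fin d) := ⟨⟨0, hd⟩⟩
    have hne : G ≠ Set.univ := fun h => NormedSpace.unbounded_univ ℝ (Euc d) (h ▸ hGb)
    exact continuousAt_innerTubeVolume hG hGb.measure_lt_top.ne hne hx
  eq_sum := hpoly
  eq_lam := hlam
  piecewise := hlamC1
  eq_const x hx := by
    rw [hκd, neg_neg]
    exact innerTubeVolume_eq_volume_of_inradius_le hd hG hGb (hg ▸ hx)

namespace IsTubeFunction

variable {d J : ℕ} {r : Fin J → ℝ} {κ : ℕ → ℝ} {h g c ε : ℝ} {lam V : ℝ → ℝ}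

theorem integrable_geometricZeta_vertical (H : IsTubeFunction V d κ h g lam) (hr : ∀ j, 0 < r j)
    (hr1 : ∀ j, r j < 1) (hc : ∑ j, r j ^ c < 1) (hcd : ∀ i ≤ d, c ≠ (i : ℕ)) (hε : 0 < ε) :
    Integrable fun t : ℝ => geometricZeta d r κ h g lam ε (c + t * Complex.I) := by
  simp only [geometricZeta_eq, mul_assoc]
  exact integrable_inv_scalingDenom_mul_vertical hr hr1 hc
    (integrable_cpow_mul_vertical (H.integrable_tubeTransform_vertical hcd) hε d c)

theorem hasSum_iterate (H : IsTubeFunction V d κ h g lam) (hr : ∀ j, 0 < r j)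
    (hc : ∑ j, r j ^ c < 1) (hdc : (d : ℝ) - 1 < c) (hcd : c < d) {W : ℕ → ℝ → ℝ}
    (hW_zero : W 0 = V) (hW_succ : ∀ k x, W (k + 1) x = ∑ j, r j ^ d * W k (x / r j))
    (hε : 0 < ε) :
    HasSum (fun k => (W k ε : ℂ)) ((1 / (2 * Real.pi) : ℝ) *
      ∫ t : ℝ, geometricZeta d r κ h g lam ε (c + t * Complex.I)) := by
  simp only [geometricZeta_eq, mul_assoc]
  exact hasSum_iterate_integral_vertical (W := fun k x => (W k x : ℂ)) hr hc
    (H.integrable_tubeTransform_vertical fun i _ => ne_natCast_of_sub_one_lt_of_lt hdc hcd i)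
    (fun x hx => hW_zero ▸ H.eq_integral_tubeTransform hdc hcd hx)
    (fun k x => by simp [hW_succ]) hε

end IsTubeFunction

theorem mainTheorem1_general {d J : ℕ} (Φ : Fin J → Euc d → Euc d) (r : Fin J → ℝ)
    (C : Set (Euc d)) (hr : ∀ j, 0 < r j) (hr1 : ∀ j, r j < 1)
    (hΦ : ∀ j x y, dist (Φ j x) (Φ j y) = r j * dist x y) (hC : Bornology.IsBounded C)
    (htile : TilesetCondition Φ C) (D : ℝ) (hD : ∑ j, r j ^ D = 1) (hdD : (d : ℝ) - 1 < D)
    (hDd : D < d) (h g : ℝ) (κ : ℕ → ℝ) (lam : ℝ → ℝ) (hg : g = inradius (tile Φ C 0))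
    (hh : 0 < h) (hhg : h < g)
    (hpoly : ∀ ε, 0 < ε → ε < h →
      innerTubeVolume (tile Φ C 0) ε = ∑ i ∈ Finset.range d, κ i * ε ^ (d - i))
    (hlam : ∀ ε, h ≤ ε → ε ≤ g → innerTubeVolume (tile Φ C 0) ε = lam ε)
    (hlamC1 : PiecewiseC1On lam h g)
    (hκd : κ d = -(volume : Measure (Euc d)).real (tile Φ C 0)) :
    (∀ t : ℝ, {ω ∈ tilingDimensions d r | |ω.im| ≤ t}.Finite) ∧
    ∃ τ : ℕ → ℝ, StrictMono τ ∧ Tendsto τ atTop atTop ∧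
      ∀ ε, 0 < ε → ε < h →
        Summable (fun n => innerTubeVolume (tile Φ C n) ε) ∧
        Tendsto
          (fun n => ∑ᶠ ω ∈ {ω ∈ tilingDimensions d r | |ω.im| ≤ τ n},
            residue (geometricZeta d r κ h g lam ε) ω)
          atTop (𝓝 (tilingTubeVolume Φ C ε : ℂ)) := by
  have hd : 0 < d := by exact_mod_cast (nonneg_of_sum_rpow_eq_one hr hr1 hD).trans_lt hDd
  have H := isTubeFunction_innerTubeVolume hd (isOpen_tile hr hΦ C 0)
    (hC.subset ((tile_subset_interior htile 0).trans interior_subset)) hg hh hhg hpoly hlam hlamC1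
    hκd
  obtain ⟨δ, hδ, τ, hτ_mono, hτ_lim, hτ⟩ := exists_heights_le_norm_scalingDenom hr hr1 hD
  refine ⟨finite_tilingDimensions_strip hr hr1 hD d, τ, hτ_mono, hτ_lim, fun ε hε hεh => ?_⟩
  obtain ⟨c, hDc, hcd⟩ := exists_between hDd
  have hdc : (d : ℝ) - 1 < c := hdD.trans hDc
  have hc : ∑ j, r j ^ c < 1 := sum_rpow_lt_one hr hr1 hD hDc
  have hsum := H.hasSum_iterate (W := fun k => innerTubeVolume (tile Φ C k)) hr hc hdc hcd rfl
    (innerTubeVolume_tile_succ hr hΦ htile hC hd) hε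
  refine ⟨Complex.summable_ofReal.1 hsum.summable, ?_⟩
  obtain ⟨K, hK⟩ := H.exists_norm_sum_residue_sub_integral_le hr hr1 hD hDc hdc hcd hε hεh hδ
  have hdiff := squeeze_zero_norm' ((hτ_lim.eventually_ge_atTop 1).mono fun n hn =>
    hK (τ n) hn (hτ n)) (hτ_lim.const_div_atTop K)
  have hline := (intervalIntegral_tendsto_integral
    (H.integrable_geometricZeta_vertical hr hr1 hc
      (fun i _ => ne_natCast_of_sub_one_lt_of_lt hdc hcd i) hε)
    (tendsto_neg_atTop_atBot.comp hτ_lim) hτ_lim).const_mul ((1 / (2 * Real.pi) : ℝ) : ℂ)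
  rw [tilingTubeVolume, Complex.ofReal_tsum, hsum.tsum_eq]
  simpa using hdiff.add hline

theorem mainTheorem1 {d J : ℕ} (Φ : Fin J → Euc d → Euc d) (r : Fin J → ℝ)
    (F C G : Set (Euc d)) (hF : IsSelfSimilar Φ r F)
    (hC : C = convexHull ℝ F) (hdim : Module.finrank ℝ (vectorSpan ℝ C) = d)
    (htile : TilesetCondition Φ C) (hnontriv : Nontriviality Φ C)
    (D : ℝ) (hD : ∑ j, r j ^ D = 1) (hdD : (d : ℝ) - 1 < D) (hDd : D < d)
    -- the tiling has the single generator `G`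
    (hG : G = tile Φ C 0) (hGconn : IsConnected G)
    (h g : ℝ) (κ : ℕ → ℝ) (lam : ℝ → ℝ)
    (hg : g = inradius G) (hh : 0 < h) (hhg : h < g)
    (hpoly : ∀ ε, 0 < ε → ε < h →
      innerTubeVolume G ε = ∑ i ∈ Finset.range d, κ i * ε ^ (d - i))
    (hlam : ∀ ε, h ≤ ε → ε ≤ g → innerTubeVolume G ε = lam ε)
    (hlamC1 : PiecewiseC1On lam h g)
    (hκd : κ d = -(volume : Measure (Euc d)).real G) :
    (∀ t : ℝ, {ω ∈ tilingDimensions d r | |ω.im| ≤ t}.Finite) ∧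
    -- the sum of residues is the limit of its truncations at suitable heights `τ n`,
    -- which do not depend on `ε`
    ∃ τ : ℕ → ℝ, StrictMono τ ∧ Tendsto τ atTop atTop ∧
      ∀ ε, 0 < ε → ε < h →
        Summable (fun n => innerTubeVolume (tile Φ C n) ε) ∧
        Tendsto
          (fun n => ∑ᶠ ω ∈ {ω ∈ tilingDimensions d r | |ω.im| ≤ τ n},
            residue (geometricZeta d r κ h g lam ε) ω)
          atTop (𝓝 (tilingTubeVolume Φ C ε : ℂ)) := by
  subst hG
  exact mainTheorem1_general Φ r C hF.ratio_pos hF.ratio_lt_one hF.similitude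
    (hC ▸ isBounded_convexHull.2 hF.isCompact.isBounded) htile D hD hdD hDd h g κ lam hg hh hhg
    hpoly hlam hlamC1 hκd
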